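/- Theorem. Let $G=(V,E)$ be a finite graph without cycles, $V=\{1,\dots,n\}$, let $X_1,\dots,X_n$ be finite sets, and put $c=\max_i|X_i|$. For $x\in X_1\times\cdots\times X_n$ let $\theta(x)=\sum_{i\in V}\theta_i(x_i)+\sum_{(i,j)\in E}\theta_{i,j}(x_i,x_j)$, where the potentials take values in $\mathbb R\cup\{-\infty\}$ and $\theta\not\equiv-\infty$, and let $p(x)=\frac1Z e^{\theta(x)}$, $Z=\sum_x e^{\theta(x)}$, be the Gibbs distribution. Let $m_1,\dots,m_n\ge 1$ be integers. Replicate each variable $x_i$ into copies $x_{i,k_i}\in X_i$, $k_i=1,\dots,m_i$, write $\hat x=(x_{i,k_i})_{i,k_i}$, and define $$\hat\theta(\hat x)=\frac{1}{\prod_i m_i}\sum_{k_1=1}^{m_1}\cdots\sum_{k_n=1}^{m_n}\theta(x_{1,k_1},\dots,x_{n,k_n}),\qquad \hat\gamma_{i,j}(\hat x)=\frac{1}{m_im_j}\sum_{k_i=1}^{m_i}\sum_{k_j=1}^{m_j}\gamma_{i,j,k_i,k_j}(x_{i,k_i},x_{j,k_j})\quad((i,j)\in E),$$ where the random variables $\gamma_{i,j,k_i,k_j}(a,b)$,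 for $(i,j)\in E$, $1\le k_i\le m_i$, $1\le k_j\le m_j$, $a\in X_i$, $b\in X_j$, are independent and follow the zero-mean Gumbel distribution, whose distribution function is $F(t)=\exp(-\exp(-(t+\gamma_0)))$ with $\gamma_0$ the Euler constant. Let $(r,s)\in E$ be an edge with $m_r=m_s=1$ and let $\varepsilon>0$. For $(x_r,x_s)\in X_r\times X_s$ let $P_\gamma[x_r,x_s\in\arg\max]$ be the probability that some maximizer $\hat x$ of $\hat\theta(\hat x)+\sum_{(i,j)\in E}\hat\gamma_{i,j}(\hat x)$ takes the values $(x_r,x_s)$ at $(r,s)$; here the probability is over the perturbations of the edge $(r,s)$, conditionally on the perturbations of all other edges, so it is a random variable. Then with probability at least $$1-\sum_{i=1}^n\frac{\pi^2c}{6\,m_i\,\varepsilon^2}$$ over the perturbations, simultaneously for all $(x_r,x_s)\in X_r\times X_s$, $$\Big|\log P_\gamma\big[x_r,x_s\in\arg\max\big]-\log\sum_{x\setminus\{x_r,x_s\}}p(x)\Big|\le\varepsilon n,$$ where the inequality is understood to hold if both logarithms are $-\infty$ and to fail if exactly one of them is. -/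

import Mathlib

open MeasureTheory ProbabilityTheory
open scoped ENNReal

/-- A pairwise graphical model on the variables `x i ∈ X i`, `i ∈ V`. Every undirected edge is
listed exactly once in `edges`, in one of its two orientations; there are no loops. The potentials
take values in `ℝ ∪ {-∞}`, where `-∞` expresses that an assignment is excluded. -/
structure PairwiseModel (V : Type*) (X : V → Type*) where
  edges : Finset (V × V)
  asymm : ∀ i j, (i, j) ∈ edges → (j, i) ∉ edges
  nodePot : ∀ i, X i → EReal
  edgePot : ∀ i j, X i → X j → EReal
  nodePot_ne_top : ∀ i a, nodePot i a ≠ ⊤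
  edgePot_ne_top : ∀ i j a b, edgePot i j a b ≠ ⊤

namespace PairwiseModel

variable {V : Type*} [Fintype V] {X : V → Type*} (M : PairwiseModel V X)

/-- The underlying undirected graph. -/
def graph {V : Type*} {X : V → Type*} (M : PairwiseModel V X) : SimpleGraph V :=
  SimpleGraph.fromRel (fun i j => (i, j) ∈ M.edges)

/-- The potential `θ(x) = ∑ i, θ_i(x_i) + ∑ (i,j) ∈ E, θ_{i,j}(x_i, x_j)`. -/
noncomputable def potential (x : ∀ i, X i) : EReal :=
  ∑ i, M.nodePot i (x i) + ∑ e ∈ M.edges, M.edgePot e.1 e.2 (x e.1) (x e.2)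

/-- The partition function `Z = ∑ x, exp θ(x)`, with `exp (-∞) = 0`. -/
noncomputable def partitionFunction [DecidableEq V] [∀ i, Fintype (X i)] : ℝ≥0∞ :=
  ∑ x : ∀ i, X i, EReal.exp (M.potential x)

/-- The Gibbs distribution `p(x) = exp θ(x) / Z`. -/
noncomputable def gibbs [DecidableEq V] [∀ i, Fintype (X i)] (x : ∀ i, X i) : ℝ≥0∞ :=
  EReal.exp (M.potential x) / M.partitionFunction

open Classical in
/-- The Gibbs marginal of `(x_r, x_s) = (a, b)`. -/
noncomputable def gibbsMarginal [DecidableEq V] [∀ i, Fintype (X i)]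
    (r s : V) (a : X r) (b : X s) : ℝ≥0∞ :=
  ∑ x : ∀ i, X i, if x r = a ∧ x s = b then M.gibbs x else 0

/-- An assignment of the extended model, in which variable `i` has the `m i` copies
`x_{i,k}`, `k < m i`. -/
abbrev ExtAssignment {V : Type*} (X : V → Type*) (m : V → ℕ) : Type _ :=
  ∀ i, Fin (m i) → X i

/-- The extended potential: the average of `θ(x_{1,k_1}, …, x_{n,k_n})` over all choices
`(k_1, …, k_n)` of one copy of each variable. -/
noncomputable def extPotential [DecidableEq V] (m : V → ℕ) (x : ExtAssignment X m) : EReal :=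
  (((∏ i, (m i : ℝ))⁻¹ : ℝ) : EReal) *
    ∑ k : (∀ i, Fin (m i)), M.potential (fun i => x i (k i))

/-- The indices of the perturbations `γ_{i,j,k_i,k_j}(a, b)`: an edge `(i,j)`, a copy of each of
its endpoints, and a label of each of its endpoints. -/
abbrev NoiseIndex {V : Type*} {X : V → Type*} (M : PairwiseModel V X) (m : V → ℕ) : Type _ :=
  Σ e : M.edges, (Fin (m e.1.1) × Fin (m e.1.2)) × (X e.1.1 × X e.1.2)

/-- The total perturbation `∑ (i,j) ∈ E, γ̂_{i,j}`, where `γ̂_{i,j}` is the average over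
`(k_i, k_j)` of `γ_{i,j,k_i,k_j}(x_{i,k_i}, x_{j,k_j})`. -/
noncomputable def extNoise {V : Type*} {X : V → Type*} (M : PairwiseModel V X) (m : V → ℕ)
    (g : M.NoiseIndex m → ℝ) (x : ExtAssignment X m) : ℝ :=
  ∑ e : M.edges,
    (∑ k : Fin (m e.1.1), ∑ l : Fin (m e.1.2), g ⟨e, (k, l), (x e.1.1 k, x e.1.2 l)⟩) /
      ((m e.1.1 : ℝ) * (m e.1.2 : ℝ))

/-- `x` is a MAP assignment of the perturbed extended model. -/
def IsPerturbedMAP [DecidableEq V] (m : V → ℕ) (g : M.NoiseIndex m → ℝ)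
    (x : ExtAssignment X m) : Prop :=
  IsMaxOn (fun y : ExtAssignment X m => M.extPotential m y + (M.extNoise m g y : EReal))
    Set.univ x

/-- The event that `(a, b)` is the value of `(x_r, x_s)` in some perturbed MAP assignment. -/
def mapEvent [DecidableEq V] (m : V → ℕ) {Ω : Type*} (γ : M.NoiseIndex m → Ω → ℝ)
    (r s : V) (a : X r) (b : X s) : Set Ω :=
  {ω | ∃ x : ExtAssignment X m, M.IsPerturbedMAP m (fun q => γ q ω) x ∧
    (∀ k, x r k = a) ∧ (∀ k, x s k = b)}

/-- The σ-algebra generated by the perturbations of all edges other than `(r, s)`. -/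
abbrev otherNoise {V : Type*} {X : V → Type*} (M : PairwiseModel V X) (m : V → ℕ) {Ω : Type*}
    (γ : M.NoiseIndex m → Ω → ℝ) (r s : V) : MeasurableSpace Ω :=
  ⨆ q : {q : M.NoiseIndex m // (q.1 : V × V) ≠ (r, s)},
    MeasurableSpace.comap (γ q.1) inferInstance

/-- The logarithm (in `[-∞, ∞]`) of the probability that `(a, b)` is the value of `(x_r, x_s)` in
the perturbed MAP assignment. The probability is over the perturbations of the edge `(r, s)`,
i.e. it is conditional on the perturbations of all the other edges. -/
noncomputable def logMapProb [DecidableEq V] (m : V → ℕ) {Ω : Type*} [MeasurableSpace Ω]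
    (μ : Measure Ω) (γ : M.NoiseIndex m → Ω → ℝ) (r s : V) (a : X r) (b : X s) (ω : Ω) : EReal :=
  ENNReal.log (ENNReal.ofReal ((μ⟦M.mapEvent m γ r s a b | M.otherNoise m γ r s⟧) ω))

end PairwiseModel

/-- `Y` follows the Gumbel distribution with zero mean, whose cumulative distribution function is
`t ↦ exp (-exp (-(t + c)))` with `c` the Euler constant. -/
def IsZeroMeanGumbel {Ω : Type*} [MeasurableSpace Ω] (μ : Measure Ω) (Y : Ω → ℝ) : Prop :=
  Measurable Y ∧ ∀ t : ℝ, μ {ω | Y ω ≤ t} =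
    ENNReal.ofReal (Real.exp (-Real.exp (-(t + Real.eulerMascheroniConstant))))

/-!
The proof compares two families of numbers indexed by the values `(a, b)` of `(x_r, x_s)`.

* By the Gumbel-max trick (`measureReal_isMax`, `PairwiseModel.condProb_mapEvent`), the conditional
  probability that `(a, b)` is the value of the maximizer is proportional to
  `A(a, b) = max exp (θ̂ + γ̂)`, the maximum over the extended assignments with these values, where
  the perturbations `γ̂` are those of the edges other than `(r, s)`.
* The Gibbs marginal is proportional to `Z(a, b) = ∑ exp θ(x)`, the sum over the assignments `x`
  with these values.

It therefore suffices to bound `A / Z` from above and from below, uniformly in `(a, b)`. Write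
`c` for the largest number of labels, `n = N + 2` for the number of variables and `v` for
`∑ 1 / m_i` over `i ≠ r, s`.

*Forest structure.* Eliminating the vertices other than `r` and `s` leaf by leaf
(`nonempty_forestBounds`) gives the two facts needed about the forest: `exp θ(x)` is at most
`Z(x_r, x_s) ∏ p_e(x_e)`, a product over the edges `e ≠ (r, s)` of transition kernels of total
mass at most `c`; and some assignment attains `Z(a, b)` up to the factor `c ^ N` while its pair of
values on each edge `e` belongs to a set `Q_e` of at most `c` pairs which does not depend on
`(a, b)`. Each edge is charged to one endpoint, and no endpoint is charged twice.

*Upper bound.* The extended potential and its perturbation are averages over the selections of one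
copy of each variable. Bounding the maximum of this average by the average of the maxima, and each
maximum by the product of kernels, yields for each edge an average of independent weighted maxima
`max (log p_e + γ)`. By max-stability these are Gumbel variables with means at most `log c`
(`PairwiseModel.extWeight_mul_exp_le`).

*Lower bound.* Giving all copies of a variable the same value, that of the assignment from the
forest structure, costs the factor `c ^ N` and, for each edge, the average perturbation of a pair
in `Q_e`, which the square root of the sum of the squares over `Q_e` dominates
(`PairwiseModel.marginal_le_maxWeight`).

Hence the logarithms of the two probabilities differ by at most `2 N log c` plus a sum of
fluctuations, one for each edge `e = (i, j) ≠ (r, s)`, whose second moment is at most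
`2 (c + 1) (π² / 6) / (m_i m_j)`, as the variance of a Gumbel variable is `π² / 6`
(`IsZeroMeanGumbel.integral_sq`). By Markov's inequality this exceeds `ε n` with probability at
most `2 N (c + 1) (π² / 6) v / (ε n - 2 N log c)²`. Since `m_r = m_s = 1`, the admissible failure
probability equals `c (π² / 6) (2 + v) / ε²`. If this is at least `1`, there is nothing to prove;
otherwise `ε` is so large compared with `√c` that `2 N log c` stays below `ε n` and the Markov
bound is within the admissible failure probability (`markov_bound_le`).
-/

/-! ### The Gumbel distribution -/

/-- The law of the logarithmic transform `-log y - γ₀` of a standard exponential variable. -/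
noncomputable def gumbelLaw : Measure ℝ :=
  ((volume.restrict (Set.Ioi (0 : ℝ))).withDensity
    (fun y => ENNReal.ofReal (Real.exp (-y)))).map
      (fun y => -Real.log y - Real.eulerMascheroniConstant)

lemma measurable_neg_log_sub :
    Measurable (fun y : ℝ => -Real.log y - Real.eulerMascheroniConstant) :=
  (Real.measurable_log.neg).sub_const _

lemma gumbelLaw_Iic (t : ℝ) : gumbelLaw (Set.Iic t) =
    ENNReal.ofReal (Real.exp (-Real.exp (-(t + Real.eulerMascheroniConstant)))) := by
  have hexp : Measurable (fun y : ℝ => ENNReal.ofReal (Real.exp (-y))) := by fun_prop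
  rw [gumbelLaw, Measure.map_apply measurable_neg_log_sub measurableSet_Iic,
    withDensity_apply _ (measurable_neg_log_sub measurableSet_Iic),
    Measure.restrict_restrict (measurable_neg_log_sub measurableSet_Iic)]
  have hset : ((fun y : ℝ => -Real.log y - Real.eulerMascheroniConstant) ⁻¹' Set.Iic t) ∩
      Set.Ioi 0 = Set.Ici (Real.exp (-(t + Real.eulerMascheroniConstant))) := by
    ext y
    simp only [Set.mem_inter_iff, Set.mem_preimage, Set.mem_Iic, Set.mem_Ioi, Set.mem_Ici]
    constructor
    · rintro ⟨h, hy⟩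
      rw [← Real.le_log_iff_exp_le hy]
      linarith
    · intro h
      have hy : 0 < y := (Real.exp_pos _).trans_le h
      rw [← Real.le_log_iff_exp_le hy] at h
      exact ⟨by linarith, hy⟩
  rw [hset, setLIntegral_congr Ioi_ae_eq_Ici.symm,
    ← ofReal_integral_eq_lintegral_ofReal, integral_exp_neg_Ioi]
  · exact integrableOn_exp_neg_Ioi _
  · exact Filter.Eventually.of_forall fun y => (Real.exp_pos _).le

lemma integral_gumbelLaw {h : ℝ → ℝ} (hh : Measurable h) : ∫ y, h y ∂gumbelLaw =
    ∫ y in Set.Ioi (0 : ℝ), Real.exp (-y) * h (-Real.log y - Real.eulerMascheroniConstant) := by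
  rw [gumbelLaw, integral_map measurable_neg_log_sub.aemeasurable hh.aestronglyMeasurable,
    integral_withDensity_eq_integral_toReal_smul (by fun_prop) (by simp)]
  simp [ENNReal.toReal_ofReal, (Real.exp_pos _).le]

lemma integrable_gumbelLaw {h : ℝ → ℝ} (hh : Measurable h)
    (hi : IntegrableOn (fun y => Real.exp (-y) *
      h (-Real.log y - Real.eulerMascheroniConstant)) (Set.Ioi (0 : ℝ))) :
    Integrable h gumbelLaw := by
  rw [gumbelLaw, integrable_map_measure hh.aestronglyMeasurable measurable_neg_log_sub.aemeasurable,
    integrable_withDensity_iff_integrable_smul' (by fun_prop) (by simp)]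
  simpa [ENNReal.toReal_ofReal, (Real.exp_pos _).le, IntegrableOn] using hi

/-- The integrand of the moment generating function of the Gumbel law is that of the Gamma
integral. -/
lemma exp_mul_gumbel_integrand (s : ℝ) {y : ℝ} (hy : y ∈ Set.Ioi (0 : ℝ)) :
    Real.exp (-y) * Real.exp (s * (-Real.log y - Real.eulerMascheroniConstant)) =
      Real.exp (-s * Real.eulerMascheroniConstant) * (Real.exp (-y) * y ^ ((1 - s) - 1)) := by
  rw [Real.rpow_def_of_pos hy, ← Real.exp_add, ← Real.exp_add, ← Real.exp_add]
  congr 1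
  ring

namespace IsZeroMeanGumbel

variable {Ω : Type*} [MeasurableSpace Ω] {μ : Measure Ω} [IsProbabilityMeasure μ] {Y : Ω → ℝ}

lemma map_eq (h : IsZeroMeanGumbel μ Y) : μ.map Y = gumbelLaw := by
  have := Measure.isProbabilityMeasure_map (μ := μ) h.1.aemeasurable
  refine Measure.ext_of_Iic _ _ fun t => ?_
  rw [gumbelLaw_Iic, Measure.map_apply h.1 measurableSet_Iic, ← h.2 t]
  rfl

lemma integral_comp (h : IsZeroMeanGumbel μ Y) {f : ℝ → ℝ} (hf : Measurable f) :
    ∫ ω, f (Y ω) ∂μ = ∫ y in Set.Ioi (0 : ℝ),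
      Real.exp (-y) * f (-Real.log y - Real.eulerMascheroniConstant) := by
  rw [← integral_gumbelLaw hf, ← h.map_eq, integral_map h.1.aemeasurable hf.aestronglyMeasurable]

lemma integrable_exp_mul (h : IsZeroMeanGumbel μ Y) {s : ℝ} (hs : s < 1) :
    Integrable (fun ω => Real.exp (s * Y ω)) μ := by
  have hm : Measurable (fun y : ℝ => Real.exp (s * y)) := by fun_prop
  have : Integrable (fun y : ℝ => Real.exp (s * y)) gumbelLaw := by
    refine integrable_gumbelLaw hm ?_
    rw [integrableOn_congr_fun (fun y hy => exp_mul_gumbel_integrand s hy) measurableSet_Ioi]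
    exact (Real.GammaIntegral_convergent (s := 1 - s) (by linarith)).const_mul _
  rw [← h.map_eq] at this
  exact this.comp_measurable h.1

lemma mgf_eq (h : IsZeroMeanGumbel μ Y) {s : ℝ} (hs : s < 1) :
    mgf Y μ s = Real.exp (-s * Real.eulerMascheroniConstant) * Real.Gamma (1 - s) := by
  rw [mgf, h.integral_comp (f := fun y => Real.exp (s * y)) (by fun_prop),
    setIntegral_congr_fun measurableSet_Ioi (fun y hy => exp_mul_gumbel_integrand s hy),
    integral_const_mul, Real.Gamma_eq_integral (by linarith)]

lemma zero_mem_interior (h : IsZeroMeanGumbel μ Y) :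
    0 ∈ interior (integrableExpSet Y μ) := by
  rw [mem_interior_iff_mem_nhds]
  filter_upwards [Iio_mem_nhds (zero_lt_one (α := ℝ))] with s hs
  exact h.integrable_exp_mul hs

lemma memLp_two (h : IsZeroMeanGumbel μ Y) : MemLp Y 2 μ :=
  memLp_of_mem_interior_integrableExpSet h.zero_mem_interior 2

lemma integral_eq_zero (h : IsZeroMeanGumbel μ Y) : ∫ ω, Y ω ∂μ = 0 := by
  rw [← deriv_mgf_zero h.zero_mem_interior]
  have heq : mgf Y μ =ᶠ[nhds 0]
      fun s => Real.exp (-s * Real.eulerMascheroniConstant) * Real.Gamma (1 - s) := by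
    filter_upwards [Iio_mem_nhds (zero_lt_one (α := ℝ))] with s hs
    exact h.mgf_eq hs
  rw [heq.deriv_eq]
  have h1 : HasDerivAt (fun s : ℝ => Real.exp (-s * Real.eulerMascheroniConstant))
      (-Real.eulerMascheroniConstant) 0 := by
    have := ((hasDerivAt_id (0 : ℝ)).neg.mul_const Real.eulerMascheroniConstant).exp
    simpa using this
  have h2 : HasDerivAt (fun s : ℝ => Real.Gamma (1 - s)) Real.eulerMascheroniConstant 0 := by
    have hG : HasDerivAt Real.Gamma (-Real.eulerMascheroniConstant) (1 - 0) := by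
      simpa using Real.hasDerivAt_Gamma_one
    have := hG.comp (0 : ℝ) ((hasDerivAt_id (0 : ℝ)).const_sub 1)
    simpa [Function.comp_def] using this
  have := (h1.mul h2).deriv
  simpa [Pi.mul_def] using this

/-- The reflection formula of the Gamma function in terms of the moment generating function. -/
lemma mgf_mul_mgf_neg_mul_sin (h : IsZeroMeanGumbel μ Y) {s : ℝ} (h1 : -1 < s) (h2 : s < 1) :
    mgf Y μ s * mgf Y μ (-s) * Real.sin (Real.pi * s) = Real.pi * s := by
  rcases eq_or_ne s 0 with rfl | hs
  · simp
  have hsin : Real.sin (Real.pi * s) ≠ 0 := by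
    rw [Real.sin_ne_zero_iff]
    intro n hn
    have hn' : (n : ℝ) = s := by
      rw [mul_comm] at hn
      exact mul_left_cancel₀ Real.pi_ne_zero hn
    rw [← hn'] at h1 h2 hs
    have : -1 < n := by exact_mod_cast h1
    have : n < 1 := by exact_mod_cast h2
    have : n ≠ 0 := by exact_mod_cast hs
    omega
  have hrefl := Real.Gamma_mul_Gamma_one_sub s
  rw [h.mgf_eq h2, h.mgf_eq (by linarith : -s < 1), sub_neg_eq_add, add_comm 1 s,
    Real.Gamma_add_one hs]
  have he : Real.exp (-s * Real.eulerMascheroniConstant) *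
      Real.exp (- -s * Real.eulerMascheroniConstant) = 1 := by
    rw [← Real.exp_add]; simp
  calc _ = (Real.exp (-s * Real.eulerMascheroniConstant) *
      Real.exp (- -s * Real.eulerMascheroniConstant)) * s *
        (Real.Gamma s * Real.Gamma (1 - s)) * Real.sin (Real.pi * s) := by ring
    _ = Real.pi * s := by
      rw [he, hrefl, one_mul, mul_assoc, div_mul_cancel₀ _ hsin, mul_comm]

/-- The variance is read off the third-order Taylor coefficients of the two sides of the
reflection formula `M(s) M(-s) sin (π s) = π s`, with `M` the moment generating function. -/
lemma integral_sq (h : IsZeroMeanGumbel μ Y) : ∫ ω, Y ω ^ 2 ∂μ = Real.pi ^ 2 / 6 := by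
  have hM : ContDiffAt ℝ 3 (mgf Y μ) 0 := (analyticAt_mgf h.zero_mem_interior).contDiffAt
  have hMneg : ContDiffAt ℝ 3 (fun s => mgf Y μ (-s)) 0 := by
    have hM' : ContDiffAt ℝ 3 (mgf Y μ) (-0) := by simpa using hM
    exact hM'.comp (0 : ℝ) contDiffAt_id.neg
  have hsin : ContDiffAt ℝ 3 (fun s => Real.sin (Real.pi * s)) 0 := by fun_prop
  have hm0 : mgf Y μ 0 = 1 := by simp
  have hm1 : iteratedDeriv 1 (mgf Y μ) 0 = 0 := by
    rw [iteratedDeriv_mgf_zero h.zero_mem_interior]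
    simpa using h.integral_eq_zero
  have hm2 : iteratedDeriv 2 (mgf Y μ) 0 = ∫ ω, Y ω ^ 2 ∂μ := by
    rw [iteratedDeriv_mgf_zero h.zero_mem_interior]
    rfl
  have heq : (fun s => mgf Y μ s * mgf Y μ (-s) * Real.sin (Real.pi * s)) =ᶠ[nhds 0]
      fun s => Real.pi * s := by
    filter_upwards [Ioo_mem_nhds (by norm_num : (-1 : ℝ) < 0) (zero_lt_one (α := ℝ))] with s hs
    exact h.mgf_mul_mgf_neg_mul_sin hs.1 hs.2
  have hneg : ∀ n, iteratedDeriv n (fun s => mgf Y μ (-s)) 0 =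
      (-1) ^ n * iteratedDeriv n (mgf Y μ) 0 := fun n => by
    rw [iteratedDeriv_comp_neg]; simp
  have hS : ∀ n, iteratedDeriv n (fun s => Real.sin (Real.pi * s)) 0 =
      Real.pi ^ n * iteratedDeriv n Real.sin 0 := fun n => by
    rw [iteratedDeriv_comp_const_mul (Real.contDiff_sin)]; simp
  have hP1 : iteratedDeriv 1 (fun s => mgf Y μ s * mgf Y μ (-s)) 0 = 0 := by
    rw [iteratedDeriv_fun_mul (n := 1) (hM.of_le (by norm_num)) (hMneg.of_le (by norm_num))]
    simp [Finset.sum_range_succ, hneg, hm1]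
  have hP2 : iteratedDeriv 2 (fun s => mgf Y μ s * mgf Y μ (-s)) 0 =
      2 * ∫ ω, Y ω ^ 2 ∂μ := by
    rw [iteratedDeriv_fun_mul (n := 2) (hM.of_le (by norm_num)) (hMneg.of_le (by norm_num))]
    simp [Finset.sum_range_succ, hneg, hm1, hm2]
    ring
  have h3 := heq.iteratedDeriv_eq 3
  rw [iteratedDeriv_fun_mul (n := 3) (hM.mul hMneg) hsin] at h3
  have hlin : iteratedDeriv 3 (fun s : ℝ => Real.pi * s) 0 = 0 := by
    simp [iteratedDeriv_succ']
  have hs1 : iteratedDeriv 1 Real.sin 0 = 1 := by simp [iteratedDeriv_one]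
  have hs2 : iteratedDeriv 2 Real.sin 0 = 0 := by simp [iteratedDeriv_succ']
  have hs3 : iteratedDeriv 3 Real.sin 0 = -1 := by simp [iteratedDeriv_succ']
  rw [hlin] at h3
  simp only [Finset.sum_range_succ, Finset.range_zero, Finset.sum_empty, hS, hP1, hP2, hs1, hs2,
    hs3] at h3
  norm_num [Nat.choose] at h3
  have hpi := Real.pi_pos
  have : Real.pi * (6 * (∫ ω, Y ω ^ 2 ∂μ) - Real.pi ^ 2) = 0 := by linarith
  rcases mul_eq_zero.1 this with h' | h'
  · exact absurd h' hpi.ne'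
  · linarith

end IsZeroMeanGumbel

/-! ### Maxima of independent Gumbel variables -/

section GumbelMax

variable {Ω : Type*} [MeasurableSpace Ω] {μ : Measure Ω}

/-- The distribution function of a Gumbel variable in multiplicative form, which also makes sense
for a vanishing weight. -/
lemma IsZeroMeanGumbel.measure_mul_exp_le {Y : Ω → ℝ} [IsProbabilityMeasure μ]
    (h : IsZeroMeanGumbel μ Y) {w u : ℝ} (hw : 0 ≤ w) (hu : 0 < u) :
    μ {ω | w * Real.exp (Y ω) ≤ u} =
      ENNReal.ofReal (Real.exp (-(w / u * Real.exp (-Real.eulerMascheroniConstant)))) := by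
  rcases hw.eq_or_lt with rfl | hw
  · simp [hu.le]
  have hset : {ω | w * Real.exp (Y ω) ≤ u} = {ω | Y ω ≤ Real.log (u / w)} := by
    ext ω
    rw [Set.mem_ofPred_eq, Set.mem_ofPred_eq, Real.le_log_iff_exp_le (div_pos hu hw),
      le_div_iff₀' hw]
  rw [hset, h.2, neg_add, Real.exp_add, ← Real.log_inv, Real.exp_log (by positivity), inv_div]

variable {I : Type*} {Γ : I → Ω → ℝ}

/-- Independence turns the distribution function of a weighted maximum of Gumbel variables into
that of a single Gumbel variable whose weight is the sum of the weights. -/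
lemma measure_forall_mul_exp_le [IsProbabilityMeasure μ] (hind : iIndepFun Γ μ)
    (hΓ : ∀ q, IsZeroMeanGumbel μ (Γ q)) (S : Finset I) {w : I → ℝ} (hw : ∀ q, 0 ≤ w q)
    {u : ℝ} (hu : 0 < u) :
    μ {ω | ∀ q ∈ S, w q * Real.exp (Γ q ω) ≤ u} = ENNReal.ofReal
      (Real.exp (-((∑ q ∈ S, w q) / u * Real.exp (-Real.eulerMascheroniConstant)))) := by
  have hset : {ω | ∀ q ∈ S, w q * Real.exp (Γ q ω) ≤ u} =
      ⋂ q ∈ S, Γ q ⁻¹' {t | w q * Real.exp t ≤ u} := by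
    ext ω; simp
  rw [hset, hind.measure_inter_preimage_eq_mul S fun q _ => measurableSet_le (by fun_prop)
    measurable_const]
  calc ∏ q ∈ S, μ (Γ q ⁻¹' {t | w q * Real.exp t ≤ u})
      = ∏ q ∈ S, ENNReal.ofReal
          (Real.exp (-(w q / u * Real.exp (-Real.eulerMascheroniConstant)))) :=
        Finset.prod_congr rfl fun q _ => (hΓ q).measure_mul_exp_le (hw q) hu
    _ = _ := by
        rw [← ENNReal.ofReal_prod_of_nonneg fun _ _ => (Real.exp_pos _).le, ← Real.exp_sum,
          Finset.sum_neg_distrib, Finset.sum_div, Finset.sum_mul]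

/-- The logarithm of a weighted maximum of exponentials. -/
noncomputable def logMaxExp {I : Type*} (w : I → ℝ) (g : I → ℝ) : ℝ :=
  Real.log (⨆ q, w q * Real.exp (g q))

lemma measurable_logMaxExp [Countable I] (w : I → ℝ) : Measurable (logMaxExp w) := by
  refine Real.measurable_log.comp (Measurable.iSup fun q => ?_)
  fun_prop

variable [Fintype I]

lemma iSup_mul_exp_pos {w : I → ℝ} (hw : ∀ q, 0 ≤ w q) (hsum : 0 < ∑ q, w q) (g : I → ℝ) :
    0 < ⨆ q, w q * Real.exp (g q) := by
  obtain ⟨q, -, hq⟩ := (Finset.sum_pos_iff_of_nonneg fun q _ => hw q).1 hsum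
  exact (mul_pos hq (Real.exp_pos _)).trans_le
    (le_ciSup (f := fun q => w q * Real.exp (g q)) (Set.finite_range _).bddAbove q)

lemma log_add_le_logMaxExp (w : I → ℝ) (g : I → ℝ) {q : I} (hq : 0 < w q) :
    Real.log (w q) + g q ≤ logMaxExp w g := by
  have hlog : Real.log (w q * Real.exp (g q)) = Real.log (w q) + g q := by
    rw [Real.log_mul hq.ne' (Real.exp_pos _).ne', Real.log_exp]
  rw [← hlog]
  exact Real.log_le_log (by positivity)
    (le_ciSup (f := fun q => w q * Real.exp (g q)) (Set.finite_range _).bddAbove q)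

/-- Max-stability of the Gumbel distribution. -/
lemma isZeroMeanGumbel_logMaxExp [IsProbabilityMeasure μ] (hind : iIndepFun Γ μ)
    (hΓ : ∀ q, IsZeroMeanGumbel μ (Γ q)) {w : I → ℝ} (hw : ∀ q, 0 ≤ w q)
    (hsum : 0 < ∑ q, w q) :
    IsZeroMeanGumbel μ (fun ω => logMaxExp w (fun q => Γ q ω) - Real.log (∑ q, w q)) := by
  obtain ⟨q₀, -, -⟩ := (Finset.sum_pos_iff_of_nonneg fun q _ => hw q).1 hsum
  have : Nonempty I := ⟨q₀⟩
  refine ⟨((measurable_logMaxExp w).comp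
    (measurable_pi_lambda _ fun q => (hΓ q).1)).sub_const _, fun t => ?_⟩
  have hset : {ω | logMaxExp w (fun q => Γ q ω) - Real.log (∑ q, w q) ≤ t} =
      {ω | ∀ q ∈ Finset.univ, w q * Real.exp (Γ q ω) ≤ (∑ q, w q) * Real.exp t} := by
    ext ω
    rw [Set.mem_ofPred_eq, Set.mem_ofPred_eq, sub_le_iff_le_add, logMaxExp,
      Real.log_le_iff_le_exp (iSup_mul_exp_pos hw hsum _), Real.exp_add, Real.exp_log hsum,
      ciSup_le_iff (Set.finite_range _).bddAbove, mul_comm (Real.exp t)]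
    simp
  rw [hset, measure_forall_mul_exp_le hind hΓ _ hw (mul_pos hsum (Real.exp_pos t)),
    div_mul_cancel_left₀ hsum.ne', ← Real.exp_neg, ← Real.exp_add, neg_add]

/-- The Gumbel-max trick: the weighted maximum of independent Gumbel variables is attained at an
index with probability proportional to its weight. -/
lemma measureReal_isMax [IsProbabilityMeasure μ] (hind : iIndepFun Γ μ)
    (hΓ : ∀ q, IsZeroMeanGumbel μ (Γ q)) {w : I → ℝ} (hw : ∀ q, 0 ≤ w q)
    (hsum : 0 < ∑ q, w q) (i : I) :
    μ.real {ω | ∀ q, w q * Real.exp (Γ q ω) ≤ w i * Real.exp (Γ i ω)} = w i / ∑ q, w q := by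
  classical
  rcases (hw i).eq_or_lt with hi | hi
  · obtain ⟨q₀, -, hq₀⟩ := (Finset.sum_pos_iff_of_nonneg fun q _ => hw q).1 hsum
    have : {ω | ∀ q, w q * Real.exp (Γ q ω) ≤ w i * Real.exp (Γ i ω)} = ∅ := by
      ext ω
      simp only [Set.mem_ofPred_eq, Set.mem_empty_iff_false, iff_false, not_forall, not_le]
      refine ⟨q₀, ?_⟩
      rw [← hi, zero_mul]
      positivity
    rw [this, ← hi]
    simp
  set T : Finset I := Finset.univ.erase i with hT
  set κ : ℝ := (∑ q ∈ T, w q) / w i with hκ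
  have hκ0 : 0 ≤ κ := div_nonneg (Finset.sum_nonneg fun q _ => hw q) hi.le
  have hindT : IndepFun (Γ i) (fun ω (q : T) => Γ q ω) μ := by
    have h := hind.indepFun_finset {i} T (by simp [hT]) fun q => (hΓ q).1
    exact h.comp (φ := fun x : ({i} : Finset I) → ℝ => x ⟨i, by simp⟩)
      (ψ := fun x : T → ℝ => x) (measurable_pi_apply _) measurable_id
  have hmT : Measurable fun ω (q : T) => Γ q ω := measurable_pi_lambda _ fun q => (hΓ q).1
  rw [indepFun_iff_map_prod_eq_prod_map_map (hΓ i).1.aemeasurable hmT.aemeasurable] at hindT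
  set B : Set (ℝ × (T → ℝ)) :=
    {z | ∀ q : T, w q * Real.exp (z.2 q) ≤ w i * Real.exp z.1} with hB
  have hBm : MeasurableSet B := by
    rw [hB, Set.ofPred_forall]
    refine MeasurableSet.iInter fun q => measurableSet_le ?_ ?_ <;> fun_prop
  have hset : {ω | ∀ q, w q * Real.exp (Γ q ω) ≤ w i * Real.exp (Γ i ω)} =
      (fun ω => (Γ i ω, fun q : T => Γ q ω)) ⁻¹' B := by
    ext ω
    simp only [Set.mem_ofPred_eq, Set.mem_preimage, hB]
    refine ⟨fun h q => h q, fun h q => ?_⟩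
    by_cases hq : q = i
    · rw [hq]
    · exact h ⟨q, by simp [hT, hq]⟩
  have hmeas : μ {ω | ∀ q, w q * Real.exp (Γ q ω) ≤ w i * Real.exp (Γ i ω)} =
      ∫⁻ x, ENNReal.ofReal
        (Real.exp (-(κ * Real.exp (-(x + Real.eulerMascheroniConstant))))) ∂gumbelLaw := by
    rw [hset, ← Measure.map_apply ((hΓ i).1.prodMk hmT) hBm, hindT, Measure.prod_apply hBm,
      (hΓ i).map_eq]
    refine lintegral_congr fun x => ?_
    rw [Measure.map_apply hmT (measurable_prodMk_left hBm)]
    have := measure_forall_mul_exp_le hind hΓ T hw (mul_pos hi (Real.exp_pos x))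
    have hset' : (fun ω (q : T) => Γ q ω) ⁻¹' (Prod.mk x ⁻¹' B) =
        {ω | ∀ q ∈ T, w q * Real.exp (Γ q ω) ≤ w i * Real.exp x} := by
      ext ω; simp [hB]
    rw [hset', this, neg_add, Real.exp_add, hκ, Real.exp_neg x]
    congr 3
    field_simp
  have hf : Measurable fun x : ℝ =>
      Real.exp (-(κ * Real.exp (-(x + Real.eulerMascheroniConstant)))) := by fun_prop
  rw [Measure.real, hmeas, ← integral_eq_lintegral_of_nonneg_ae
    (Filter.Eventually.of_forall fun _ => (Real.exp_pos _).le) hf.aestronglyMeasurable,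
    integral_gumbelLaw hf]
  calc ∫ y in Set.Ioi (0 : ℝ), Real.exp (-y) * Real.exp (-(κ * Real.exp
        (-(-Real.log y - Real.eulerMascheroniConstant + Real.eulerMascheroniConstant))))
      = ∫ y in Set.Ioi (0 : ℝ), Real.exp (-(1 + κ) * y) := by
        refine setIntegral_congr_fun measurableSet_Ioi fun y (hy : 0 < y) => ?_
        simp only [sub_add_cancel, neg_neg]
        rw [Real.exp_log hy, ← Real.exp_add]
        congr 1
        ring
    _ = 1 / (1 + κ) := by
        rw [integral_exp_mul_Ioi (by linarith), mul_zero, Real.exp_zero, neg_div_neg_eq]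
    _ = w i / ∑ q, w q := by
        have : ∑ q, w q = w i + ∑ q ∈ T, w q :=
          (Finset.add_sum_erase _ _ (Finset.mem_univ i)).symm
        rw [this, hκ]
        field_simp

end GumbelMax

/-! ### Elimination orders of forests -/

namespace SimpleGraph

variable {V : Type*} {G : SimpleGraph V}

/-- In a forest, at most one neighbour of a vertex `j` is at most as far from a given vertex of
the component of `j` as `j` itself. -/
lemma IsAcyclic.eq_of_adj_of_dist_le (hG : G.IsAcyclic) {ρ j i i' : V}
    (hi : G.Adj j i) (hi' : G.Adj j i') (hr : G.Reachable ρ j)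
    (hd : G.dist ρ i ≤ G.dist ρ j) (hd' : G.dist ρ i' ≤ G.dist ρ j) : i = i' := by
  classical
  have key : ∀ {i : V}, G.Adj j i → G.dist ρ i ≤ G.dist ρ j →
      ∃ p : G.Walk ρ j, p.IsPath ∧ p.penultimate = i := by
    intro i hi hd
    obtain ⟨p, hp, hl⟩ := (hr.trans hi.reachable).exists_path_of_dist
    have hj : j ∉ p.support := fun hj => by
      have h1 := p.length_takeUntil_lt_length hj hi.ne
      have h2 := dist_le (p.takeUntil j hj)
      omega
    exact ⟨p.concat hi.symm, hp.concat hj hi.symm, p.penultimate_concat hi.symm⟩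
  obtain ⟨p, hp, rfl⟩ := key hi hd
  obtain ⟨q, hq, rfl⟩ := key hi' hd'
  have := (hG.subsingleton_path ρ j).elim ⟨p, hp⟩ ⟨q, hq⟩
  rw [Subtype.mk.injEq] at this
  rw [this]

/-- A nonempty set `U` of vertices that avoids the edge `rs` of a forest contains a vertex with at
most one neighbour in `U ∪ {r, s}`: take a vertex at maximal distance from the root of its
component, the root of the component of `rs` being `r`. -/
lemma IsAcyclic.exists_subsingleton_neighbors (hG : G.IsAcyclic) {r s : V} (hrs : G.Adj r s)
    {U : Finset V} (hU : U.Nonempty) (hrU : r ∉ U) :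
    ∃ j ∈ U, ∀ i i', (i ∈ U ∨ i = r ∨ i = s) → (i' ∈ U ∨ i' = r ∨ i' = s) →
      G.Adj j i → G.Adj j i' → i = i' := by
  classical
  let root : V → V := fun j =>
    if G.connectedComponentMk j = G.connectedComponentMk r then r
    else (G.connectedComponentMk j).out
  have hroot : ∀ j, G.Reachable (root j) j := fun j => by
    by_cases h : G.connectedComponentMk j = G.connectedComponentMk r
    · simp only [root, h, if_true]
      exact (ConnectedComponent.exact h).symm
    · simp only [root, h, if_false]
      exact ConnectedComponent.exact (Quot.out_eq _)
  have hadj : ∀ {i j}, G.Adj j i → root i = root j := fun {i j} h => by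
    have : G.connectedComponentMk i = G.connectedComponentMk j :=
      ConnectedComponent.sound h.symm.reachable
    simp only [root, this]
  have hrr : root r = r := by simp [root]
  have hsr : root s = r := by rw [hadj hrs, hrr]
  obtain ⟨j, hjU, hmax⟩ := U.exists_max_image (fun j => G.dist (root j) j) hU
  refine ⟨j, hjU, ?_⟩
  have key : ∀ i, (i ∈ U ∨ i = r ∨ i = s) → G.Adj j i →
      G.dist (root j) i ≤ G.dist (root j) j := by
    rintro i (hi | rfl | rfl) hji
    · rw [← hadj hji]
      simpa [hadj hji] using hmax i hi
    · rw [← hadj hji, hrr]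
      simp
    · have hjr : root j = r := by rw [← hadj hji, hsr]
      have h1 : G.dist r i = 1 := dist_eq_one_iff_adj.2 hrs
      have h2 : 0 < G.dist r j := by
        have := hroot j
        rw [hjr] at this
        exact this.pos_dist_of_ne fun h => hrU (h ▸ hjU)
      rw [hjr]
      omega
  exact fun i i' hi hi' hji hji' =>
    hG.eq_of_adj_of_dist_le hji hji' (hroot j) (key i hi hji) (key i' hi' hji')

end SimpleGraph

/-! ### Factorization of weights over a forest -/

section Forest

/-- Every nonnegative weight `H a b` factors into its sum over `b` and a stochastic kernel, and the
largest weight in each row is at least the average of the row. -/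
lemma exists_stochastic_kernel {A B : Type*} [Fintype B] [Nonempty B] {H : A → B → ℝ}
    (hH : ∀ a b, 0 ≤ H a b) :
    ∃ (q : A → B → ℝ) (sel : A → B), (∀ a b, 0 ≤ q a b) ∧ (∀ a, ∑ b, q a b = 1) ∧
      (∀ a b, H a b = (∑ b', H a b') * q a b) ∧
      ∀ a, ∑ b, H a b ≤ Fintype.card B * H a (sel a) := by
  classical
  have hsel : ∀ a, ∃ b, ∀ b', H a b' ≤ H a b := fun a => Finite.exists_max (H a)
  choose sel hsel using hsel
  have hcard : (0 : ℝ) < Fintype.card B := by exact_mod_cast Fintype.card_pos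
  -- A row of zeros carries no information, and any stochastic vector serves there.
  refine ⟨fun a b => if ∑ b', H a b' = 0 then (Fintype.card B : ℝ)⁻¹
    else H a b / ∑ b', H a b', sel, fun a b => ?_, fun a => ?_, fun a b => ?_, fun a => ?_⟩
  · dsimp only
    split_ifs
    · positivity
    · exact div_nonneg (hH a b) (Finset.sum_nonneg fun b' _ => hH a b')
  · dsimp only
    split_ifs with h
    · simp
    · rw [← Finset.sum_div, div_self h]
  · dsimp only
    split_ifs with h
    · rw [h, zero_mul]
      exact (Finset.sum_eq_zero_iff_of_nonneg fun b' _ => hH a b').1 h b (Finset.mem_univ b)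
    · rw [mul_div_cancel₀ _ h]
  · calc ∑ b, H a b ≤ ∑ _b : B, H a (sel a) := Finset.sum_le_sum fun b _ => hsel a b
      _ = _ := by simp

lemma prod_update_mul {V : Type*} [DecidableEq V] {X : V → Type*} {T : Finset V} {i : V}
    (hi : i ∈ T) (f : ∀ i, X i → ℝ) (g : X i → ℝ) (x : ∀ i, X i) :
    ∏ k ∈ T, Function.update f i (fun u => f i u * g u) k (x k) =
      (∏ k ∈ T, f k (x k)) * g (x i) := by
  rw [← Finset.mul_prod_erase T _ hi, ← Finset.mul_prod_erase T (fun k => f k (x k)) hi,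
    Function.update_self]
  have : ∏ k ∈ T.erase i, Function.update f i (fun u => f i u * g u) k (x k) =
      ∏ k ∈ T.erase i, f k (x k) :=
    Finset.prod_congr rfl fun k hk => by rw [Function.update_of_ne (Finset.ne_of_mem_erase hk)]
  rw [this]
  ring

variable {V : Type*} [Fintype V] [DecidableEq V] {X : V → Type*} [∀ i, Fintype (X i)]

open Classical in
/-- The sum of `w` over all assignments that agree with `x` outside `U`. -/
noncomputable def sumOver (U : Finset V) (w : (∀ i, X i) → ℝ) (x : ∀ i, X i) : ℝ :=
  ∑ y with ∀ i ∉ U, y i = x i, w y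

lemma sumOver_empty (w : (∀ i, X i) → ℝ) (x : ∀ i, X i) : sumOver ∅ w x = w x := by
  classical
  rw [sumOver, Finset.sum_eq_single_of_mem x (by simp)]
  intro y hy hyx
  simp only [Finset.notMem_empty, not_false_eq_true, forall_const, Finset.mem_filter,
    Finset.mem_univ, true_and] at hy
  exact absurd (funext hy) hyx

lemma sumOver_insert {U : Finset V} {j : V} (hj : j ∉ U) (w : (∀ i, X i) → ℝ) (x : ∀ i, X i) :
    sumOver (insert j U) w x = sumOver U (fun y => ∑ v, w (Function.update y j v)) x := by
  classical
  rw [sumOver, sumOver, Finset.sum_sigma']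
  refine Finset.sum_bij' (fun y _ => (⟨Function.update y j (x j), y j⟩ : (_ : ∀ i, X i) × X j))
    (fun z _ => Function.update z.1 j z.2) ?_ ?_ ?_ ?_ ?_
  · intro y hy
    simp only [Finset.mem_insert, not_or, and_imp, Finset.mem_filter, Finset.mem_univ,
      true_and, Finset.mem_sigma, and_true] at hy ⊢
    intro i hi
    by_cases hij : i = j
    · subst hij; simp
    · rw [Function.update_of_ne hij, hy i hij hi]
  · intro z hz
    simp only [Finset.mem_insert, not_or, and_imp, Finset.mem_filter, Finset.mem_univ,
      true_and, Finset.mem_sigma, and_true] at hz ⊢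
    intro i hij hi
    rw [Function.update_of_ne hij, hz i hi]
  · intro y hy
    simp
  · intro z hz
    simp only [Finset.mem_filter, Finset.mem_univ, true_and, Finset.mem_sigma, and_true] at hz
    rcases z with ⟨y, v⟩
    have : y j = x j := hz j hj
    simp [← this]
  · intro y hy
    simp

/-- Local bounds for a weight `w` in terms of the edges `E` of a forest: after elimination of the
vertices `U`, the weight is dominated by its marginal times a product of edge factors, each of
total mass between `1` and `c`, and up to a factor `c ^ |U|` the marginal is attained by an
assignment whose values on each edge belong to a set of at most `c` pairs. Each edge is charged
to one of its endpoints, and no vertex is charged twice. -/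
structure ForestBounds (c : ℕ) (E : Finset (V × V)) (U : Finset V) (w : (∀ i, X i) → ℝ) where
  /-- The endpoint to which an edge is charged. -/
  child : V × V → V
  child_mem : ∀ e ∈ E, child e ∈ U
  child_eq : ∀ e ∈ E, child e = e.1 ∨ child e = e.2
  child_injOn : Set.InjOn child E
  /-- The edge factors. -/
  factor : ∀ e : V × V, X e.1 → X e.2 → ℝ
  factor_nonneg : ∀ e ∈ E, ∀ a b, 0 ≤ factor e a b
  one_le_sum_factor : ∀ e ∈ E, 1 ≤ ∑ a, ∑ b, factor e a b
  sum_factor_le : ∀ e ∈ E, ∑ a, ∑ b, factor e a b ≤ c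
  /-- The pairs of values which suffice to attain the marginal up to a factor. -/
  good : ∀ e : V × V, Finset (X e.1 × X e.2)
  card_good_le : ∀ e ∈ E, (good e).card ≤ c
  le_prod_factor : ∀ x, w x ≤ sumOver U w x * ∏ e ∈ E, factor e (x e.1) (x e.2)
  exists_good : ∀ x, ∃ y, (∀ i ∉ U, y i = x i) ∧ sumOver U w x ≤ c ^ U.card * w y ∧
    ∀ e ∈ E, (y e.1, y e.2) ∈ good e

variable {c : ℕ} {E : Finset (V × V)} {U : Finset V}

/-- Adding an isolated vertex. -/
lemma ForestBounds.insert_isolated {j : V} [Nonempty (X j)] (hc : Fintype.card (X j) ≤ c)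
    (hj : j ∉ U) {R : (∀ i, X i) → ℝ} (hR0 : ∀ x, 0 ≤ R x)
    (hR : ∀ x v, R (Function.update x j v) = R x) {h : X j → ℝ} (h0 : ∀ v, 0 ≤ h v)
    (hE : ∀ e ∈ E, e.1 ≠ j ∧ e.2 ≠ j)
    (B : ForestBounds c E U (fun x => R x * ∑ v, h v)) :
    Nonempty (ForestBounds c E (insert j U) (fun x => R x * h (x j))) := by
  obtain ⟨b, hb⟩ := Finite.exists_max h
  have hsum : ∀ x, sumOver (insert j U) (fun x => R x * h (x j)) x =
      sumOver U (fun x => R x * ∑ v, h v) x := fun x => by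
    rw [sumOver_insert hj]
    simp only [hR, Function.update_self, Finset.mul_sum]
  have hcard : ∑ v, h v ≤ c * h b := by
    calc ∑ v, h v ≤ ∑ _v : X j, h b := Finset.sum_le_sum fun v _ => hb v
      _ = Fintype.card (X j) * h b := by simp
      _ ≤ c * h b := by
        gcongr
        exact h0 b
  refine ⟨{ B with
    child_mem := fun e he => Finset.mem_insert_of_mem (B.child_mem e he)
    le_prod_factor := fun x => ?_
    exists_good := fun x => ?_ }⟩
  · rw [hsum]
    refine le_trans ?_ (B.le_prod_factor x)
    exact mul_le_mul_of_nonneg_left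
      (Finset.single_le_sum (fun v _ => h0 v) (Finset.mem_univ (x j))) (hR0 x)
  · obtain ⟨y, hy, hle, hgood⟩ := B.exists_good x
    refine ⟨Function.update y j b, fun i hi => ?_, ?_, fun e he => ?_⟩
    · rw [Finset.mem_insert, not_or] at hi
      rw [Function.update_of_ne hi.1, hy i hi.2]
    · rw [hsum, Finset.card_insert_of_notMem hj, hR, Function.update_self]
      calc _ ≤ (c : ℝ) ^ U.card * (R y * ∑ v, h v) := hle
        _ ≤ (c : ℝ) ^ U.card * (R y * (c * h b)) := by
          gcongr
          exact hR0 y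
        _ = _ := by ring
    · rw [Function.update_of_ne (hE e he).1, Function.update_of_ne (hE e he).2]
      exact hgood e he

/-- Adding a leaf `j` and the edge `e₀` that joins it to the vertex `i`. -/
lemma ForestBounds.insert_leaf {i j : V} [Nonempty (X j)] (hci : 1 ≤ Fintype.card (X i))
    (hc : ∀ i, Fintype.card (X i) ≤ c) (hj : j ∉ U) (hij : i ≠ j) {e₀ : V × V} (he₀ : e₀ ∉ E)
    (hor : e₀ = (i, j) ∨ e₀ = (j, i)) {R : (∀ i, X i) → ℝ} (hR0 : ∀ x, 0 ≤ R x)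
    (hR : ∀ x v, R (Function.update x j v) = R x) {H : X i → X j → ℝ} (H0 : ∀ u v, 0 ≤ H u v)
    (hE : ∀ e ∈ E, e.1 ≠ j ∧ e.2 ≠ j)
    (B : ForestBounds c E U (fun x => R x * ∑ v, H (x i) v)) :
    Nonempty (ForestBounds c (insert e₀ E) (insert j U) (fun x => R x * H (x i) (x j))) := by
  classical
  obtain ⟨q, sel, q0, q1, hq, hsel⟩ := exists_stochastic_kernel H0
  have hsum : ∀ x, sumOver (insert j U) (fun x => R x * H (x i) (x j)) x =
      sumOver U (fun x => R x * ∑ v, H (x i) v) x := fun x => by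
    rw [sumOver_insert hj]
    simp only [hR, Function.update_self, Function.update_of_ne hij, Finset.mul_sum]
  -- The kernel and the graph of `sel`, transported to the orientation of `e₀`.
  have hdata : ∃ (q' : X e₀.1 → X e₀.2 → ℝ) (Q : Finset (X e₀.1 × X e₀.2)),
      (∀ a b, 0 ≤ q' a b) ∧ (∑ a, ∑ b, q' a b = Fintype.card (X i)) ∧
      Q.card ≤ c ∧ (∀ x : ∀ i, X i, q' (x e₀.1) (x e₀.2) = q (x i) (x j)) ∧
      ∀ x : ∀ i, X i, x j = sel (x i) → (x e₀.1, x e₀.2) ∈ Q := by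
    rcases hor with rfl | rfl
    · refine ⟨q, Finset.univ.image fun u => (u, sel u), q0, by simp [q1],
        Finset.card_image_le.trans (hc i), fun x => rfl, fun x hx => ?_⟩
      exact Finset.mem_image.2 ⟨x i, Finset.mem_univ _, by rw [hx]⟩
    · refine ⟨fun v u => q u v, Finset.univ.image fun u => (sel u, u), fun a b => q0 b a, ?_,
        Finset.card_image_le.trans (hc i), fun x => rfl, fun x hx => ?_⟩
      · rw [Finset.sum_comm]
        simp [q1]
      · exact Finset.mem_image.2 ⟨x i, Finset.mem_univ _, by rw [hx]⟩
  obtain ⟨q', Q, q0', q1', hQc, hq', hQ⟩ := hdata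
  have hne : ∀ e ∈ E, e ≠ e₀ := fun e he h => he₀ (h ▸ he)
  refine ⟨{
    child := Function.update B.child e₀ j
    child_mem := fun e he => ?_
    child_eq := fun e he => ?_
    child_injOn := ?_
    factor := Function.update B.factor e₀ q'
    factor_nonneg := fun e he => ?_
    one_le_sum_factor := fun e he => ?_
    sum_factor_le := fun e he => ?_
    good := Function.update B.good e₀ Q
    card_good_le := fun e he => ?_
    le_prod_factor := fun x => ?_
    exists_good := fun x => ?_ }⟩
  · rcases Finset.mem_insert.1 he with rfl | he
    · simp
    · rw [Function.update_of_ne (hne e he)]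
      exact Finset.mem_insert_of_mem (B.child_mem e he)
  · rcases Finset.mem_insert.1 he with rfl | he
    · rcases hor with rfl | rfl <;> simp
    · rw [Function.update_of_ne (hne e he)]
      exact B.child_eq e he
  · rw [Finset.coe_insert, Set.injOn_insert (by simpa using he₀)]
    refine ⟨B.child_injOn.congr fun e he => (Function.update_of_ne (hne e he) _ _).symm, ?_⟩
    rintro ⟨e, he, h⟩
    rw [Function.update_self, Function.update_of_ne (hne e he)] at h
    exact hj (h ▸ B.child_mem e he)
  · rcases Finset.mem_insert.1 he with rfl | he
    · simpa using q0'
    · rw [Function.update_of_ne (hne e he)]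
      exact B.factor_nonneg e he
  · rcases Finset.mem_insert.1 he with rfl | he
    · rw [Function.update_self, q1']
      exact_mod_cast hci
    · rw [Function.update_of_ne (hne e he)]
      exact B.one_le_sum_factor e he
  · rcases Finset.mem_insert.1 he with rfl | he
    · rw [Function.update_self, q1']
      exact_mod_cast hc i
    · rw [Function.update_of_ne (hne e he)]
      exact B.sum_factor_le e he
  · rcases Finset.mem_insert.1 he with rfl | he
    · rwa [Function.update_self]
    · rw [Function.update_of_ne (hne e he)]
      exact B.card_good_le e he
  · have hprod : ∏ e ∈ E, Function.update B.factor e₀ q' e (x e.1) (x e.2) =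
        ∏ e ∈ E, B.factor e (x e.1) (x e.2) :=
      Finset.prod_congr rfl fun e he => by rw [Function.update_of_ne (hne e he)]
    rw [hsum, Finset.prod_insert he₀, Function.update_self, hq', hprod, hq]
    calc R x * ((∑ v, H (x i) v) * q (x i) (x j))
        = (R x * ∑ v, H (x i) v) * q (x i) (x j) := by ring
      _ ≤ (sumOver U (fun x => R x * ∑ v, H (x i) v) x *
            ∏ e ∈ E, B.factor e (x e.1) (x e.2)) * q (x i) (x j) :=
          mul_le_mul_of_nonneg_right (B.le_prod_factor x) (q0 _ _)
      _ = _ := by ring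
  · obtain ⟨y, hy, hle, hgood⟩ := B.exists_good x
    refine ⟨Function.update y j (sel (y i)), fun k hk => ?_, ?_, fun e he => ?_⟩
    · rw [Finset.mem_insert, not_or] at hk
      rw [Function.update_of_ne hk.1, hy k hk.2]
    · rw [hsum, Finset.card_insert_of_notMem hj, hR, Function.update_self,
        Function.update_of_ne hij]
      have hsel' : ∑ v, H (y i) v ≤ c * H (y i) (sel (y i)) := by
        refine (hsel (y i)).trans ?_
        gcongr
        · exact H0 _ _
        · exact hc j
      calc _ ≤ (c : ℝ) ^ U.card * (R y * ∑ v, H (y i) v) := hle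
        _ ≤ (c : ℝ) ^ U.card * (R y * (c * H (y i) (sel (y i)))) := by
          gcongr
          exact hR0 y
        _ = _ := by ring
    · rcases Finset.mem_insert.1 he with rfl | he
      · rw [Function.update_self (β := fun e : V × V => Finset (X e.1 × X e.2))]
        exact hQ _ (by rw [Function.update_self, Function.update_of_ne hij])
      · rw [Function.update_of_ne (hE e he).1, Function.update_of_ne (hE e he).2,
          Function.update_of_ne (hne e he)]
        exact hgood e he

/-- A product of vertex and edge weights over a forest admits local bounds after elimination of
all vertices but the endpoints of an edge `rs`. The vertices are eliminated one at a time; each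
one is a leaf or isolated when its turn comes, and its weights are absorbed into the vertex
weight of its only neighbour. -/
theorem nonempty_forestBounds [∀ i, Nonempty (X i)] {G : SimpleGraph V} (hG : G.IsAcyclic)
    {r s : V} (hrs : G.Adj r s) (hc : ∀ i, Fintype.card (X i) ≤ c)
    {φ : ∀ e : V × V, X e.1 → X e.2 → ℝ} (φ0 : ∀ e a b, 0 ≤ φ e a b)
    (U : Finset V) (hrU : r ∉ U) (hsU : s ∉ U) :
    ∀ (T : Finset V) (E : Finset (V × V)) (C : X r → X s → ℝ) (f : ∀ i, X i → ℝ),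
      (∀ a b, 0 ≤ C a b) → (∀ i a, 0 ≤ f i a) → (∀ i, i ∈ T ↔ i ∈ U ∨ i = r ∨ i = s) →
      (∀ e ∈ E, G.Adj e.1 e.2 ∧ e.1 ∈ T ∧ e.2 ∈ T ∧ e.swap ∉ E ∧ (e.1 ∈ U ∨ e.2 ∈ U)) →
      Nonempty (ForestBounds c E U (fun x =>
        C (x r) (x s) * (∏ i ∈ T, f i (x i)) * ∏ e ∈ E, φ e (x e.1) (x e.2))) := by
  induction hn : U.card generalizing U with
  | zero =>
    intro T E C f C0 f0 hT hE
    obtain rfl : U = ∅ := Finset.card_eq_zero.1 hn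
    obtain rfl : E = ∅ := Finset.eq_empty_of_forall_notMem fun e he => by
      simpa using (hE e he).2.2.2.2
    refine ⟨⟨fun e => e.1, by simp, by simp, by simp, fun _ _ _ => 1, by simp, by simp, by simp,
      fun _ => ∅, by simp, fun x => ?_, fun x => ⟨x, by simp, ?_, by simp⟩⟩⟩
    · rw [sumOver_empty]; simp
    · rw [sumOver_empty]; simp
  | succ n ih =>
    intro T E C f C0 f0 hT hE
    obtain ⟨j, hjU, hj⟩ := hG.exists_subsingleton_neighbors hrs
      (Finset.card_pos.1 (by omega : 0 < U.card)) hrU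
    have hrj : r ≠ j := fun h => hrU (h ▸ hjU)
    have hsj : s ≠ j := fun h => hsU (h ▸ hjU)
    have hjT : j ∈ T := (hT j).2 (Or.inl hjU)
    have hU : insert j (U.erase j) = U := Finset.insert_erase hjU
    have hjU' : j ∉ U.erase j := Finset.notMem_erase j U
    have ih' := ih (U.erase j) (fun h => hrU (Finset.mem_of_mem_erase h))
      (fun h => hsU (Finset.mem_of_mem_erase h)) (by rw [Finset.card_erase_of_mem hjU, hn]; rfl)
      (T.erase j)
    have hT' : ∀ i, i ∈ T.erase j ↔ i ∈ U.erase j ∨ i = r ∨ i = s := fun i => by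
      rw [Finset.mem_erase, Finset.mem_erase, hT]
      constructor
      · tauto
      · rintro (h | rfl | rfl)
        · tauto
        · tauto
        · tauto
    have hprodT : ∀ x : ∀ i, X i, ∏ i ∈ T, f i (x i) = f j (x j) * ∏ i ∈ T.erase j, f i (x i) :=
      fun x => (Finset.mul_prod_erase T (fun i => f i (x i)) hjT).symm
    have hRT : ∀ (x : ∀ i, X i) v,
        ∏ i ∈ T.erase j, f i (Function.update x j v i) = ∏ i ∈ T.erase j, f i (x i) := fun x v =>
      Finset.prod_congr rfl fun i hi => by rw [Function.update_of_ne (Finset.ne_of_mem_erase hi)]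
    have hRE : ∀ (E' : Finset (V × V)), (∀ e ∈ E', e.1 ≠ j ∧ e.2 ≠ j) →
        ∀ (x : ∀ i, X i) v, ∏ e ∈ E', φ e (Function.update x j v e.1)
          (Function.update x j v e.2) = ∏ e ∈ E', φ e (x e.1) (x e.2) := fun E' hE' x v =>
      Finset.prod_congr rfl fun e he => by
        rw [Function.update_of_ne (hE' e he).1, Function.update_of_ne (hE' e he).2]
    have hR0 : ∀ (E' : Finset (V × V)) (x : ∀ i, X i), 0 ≤
        C (x r) (x s) * (∏ i ∈ T.erase j, f i (x i)) * ∏ e ∈ E', φ e (x e.1) (x e.2) :=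
      fun E' x => mul_nonneg (mul_nonneg (C0 _ _) (Finset.prod_nonneg fun i _ => f0 i _))
        (Finset.prod_nonneg fun e _ => φ0 e _ _)
    have hR : ∀ (E' : Finset (V × V)), (∀ e ∈ E', e.1 ≠ j ∧ e.2 ≠ j) →
        ∀ (x : ∀ i, X i) v, C (Function.update x j v r) (Function.update x j v s) *
          (∏ i ∈ T.erase j, f i (Function.update x j v i)) *
          ∏ e ∈ E', φ e (Function.update x j v e.1) (Function.update x j v e.2) =
          C (x r) (x s) * (∏ i ∈ T.erase j, f i (x i)) * ∏ e ∈ E', φ e (x e.1) (x e.2) :=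
      fun E' hE' x v => by
        rw [hRT, hRE E' hE', Function.update_of_ne hrj, Function.update_of_ne hsj]
    by_cases htouch : ∃ e ∈ E, e.1 = j ∨ e.2 = j
    · obtain ⟨e₀, he₀, hor⟩ := htouch
      obtain ⟨i, hij, hiT, hor, ψ, ψ0, hψ⟩ : ∃ i, i ≠ j ∧ i ∈ T ∧ (e₀ = (i, j) ∨ e₀ = (j, i)) ∧
          ∃ ψ : X i → X j → ℝ, (∀ u v, 0 ≤ ψ u v) ∧
            ∀ x : ∀ i, X i, φ e₀ (x e₀.1) (x e₀.2) = ψ (x i) (x j) := by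
        obtain ⟨hadj, h1, h2, -⟩ := hE e₀ he₀
        obtain ⟨p, q⟩ := e₀
        rcases hor with rfl | rfl
        · exact ⟨q, hadj.ne', h2, Or.inr rfl, fun u v => φ (p, q) v u, fun u v => φ0 _ _ _,
            fun x => rfl⟩
        · exact ⟨p, hadj.ne, h1, Or.inl rfl, fun u v => φ (p, q) u v, fun u v => φ0 _ _ _,
            fun x => rfl⟩
      have hiT' : i ∈ T.erase j := Finset.mem_erase.2 ⟨hij, hiT⟩
      -- Any other edge at `j` would lead to `i` as well and thus be a second copy of `e₀`.
      have hmemE : ∀ e ∈ E.erase e₀, e.1 ≠ j ∧ e.2 ≠ j := by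
        intro e he
        obtain ⟨hne, he⟩ := Finset.mem_erase.1 he
        have hji : G.Adj j i := by
          rcases hor with rfl | rfl
          · exact (hE _ he₀).1.symm
          · exact (hE _ he₀).1
        obtain ⟨hadj, h1, h2, hswap, -⟩ := hE e he
        obtain ⟨p, q⟩ := e
        constructor
        · rintro rfl
          obtain rfl := hj q i ((hT q).1 h2) ((hT i).1 hiT) hadj hji
          rcases hor with rfl | rfl
          · exact hswap he₀
          · exact hne rfl
        · rintro rfl
          obtain rfl := hj p i ((hT p).1 h1) ((hT i).1 hiT) hadj.symm hji
          rcases hor with rfl | rfl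
          · exact hne rfl
          · exact hswap he₀
      set g : X i → ℝ := fun u => ∑ v, f j v * ψ u v with hg
      have g0 : ∀ u, 0 ≤ g u := fun u =>
        Finset.sum_nonneg fun v _ => mul_nonneg (f0 j v) (ψ0 u v)
      obtain ⟨B⟩ := ih' (E.erase e₀) C (Function.update f i fun u => f i u * g u) C0
        (fun k a => by
          by_cases hk : k = i
          · subst hk
            rw [Function.update_self]
            exact mul_nonneg (f0 _ _) (g0 _)
          · rw [Function.update_of_ne hk]
            exact f0 k a) hT' (fun e he => by
          obtain ⟨h1, h2, h3, h4, h5⟩ := hE e (Finset.mem_of_mem_erase he)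
          obtain ⟨h6, h7⟩ := hmemE e he
          exact ⟨h1, Finset.mem_erase.2 ⟨h6, h2⟩, Finset.mem_erase.2 ⟨h7, h3⟩,
            fun h => h4 (Finset.mem_of_mem_erase h),
            h5.imp (fun h => Finset.mem_erase.2 ⟨h6, h⟩) fun h => Finset.mem_erase.2 ⟨h7, h⟩⟩)
      simp only [prod_update_mul hiT'] at B
      rw [show (fun x : ∀ i, X i => C (x r) (x s) * ((∏ k ∈ T.erase j, f k (x k)) * g (x i)) *
          ∏ e ∈ E.erase e₀, φ e (x e.1) (x e.2)) = fun x =>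
          (C (x r) (x s) * (∏ k ∈ T.erase j, f k (x k)) *
            ∏ e ∈ E.erase e₀, φ e (x e.1) (x e.2)) * ∑ v, f j v * ψ (x i) v from
          funext fun x => by rw [hg]; ring] at B
      have := B.insert_leaf Fintype.card_pos hc hjU' hij (Finset.notMem_erase e₀ E) hor
        (hR0 _) (hR _ hmemE) (H := fun u v => f j v * ψ u v)
        (fun u v => mul_nonneg (f0 j v) (ψ0 u v)) hmemE
      rw [hU, Finset.insert_erase he₀] at this
      convert this using 2
      funext x
      rw [hprodT, ← Finset.mul_prod_erase E (fun e => φ e (x e.1) (x e.2)) he₀, hψ]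
      ring
    · push Not at htouch
      have hS : 0 ≤ ∑ v, f j v := Finset.sum_nonneg fun v _ => f0 j v
      obtain ⟨B⟩ := ih' E (fun a b => C a b * ∑ v, f j v) f
        (fun a b => mul_nonneg (C0 a b) hS) f0 hT' (fun e he => by
          obtain ⟨h1, h2, h3, h4, h5⟩ := hE e he
          obtain ⟨h6, h7⟩ := htouch e he
          exact ⟨h1, Finset.mem_erase.2 ⟨h6, h2⟩, Finset.mem_erase.2 ⟨h7, h3⟩, h4,
            h5.imp (fun h => Finset.mem_erase.2 ⟨h6, h⟩) fun h => Finset.mem_erase.2 ⟨h7, h⟩⟩)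
      rw [show (fun x : ∀ i, X i => C (x r) (x s) * (∑ v, f j v) *
          (∏ k ∈ T.erase j, f k (x k)) * ∏ e ∈ E, φ e (x e.1) (x e.2)) = fun x =>
          (C (x r) (x s) * (∏ k ∈ T.erase j, f k (x k)) *
            ∏ e ∈ E, φ e (x e.1) (x e.2)) * ∑ v, f j v from funext fun x => by ring] at B
      have := B.insert_isolated (hc j) hjU' (hR0 _) (hR _ htouch) (f0 j) htouch
      rw [hU] at this
      convert this using 2
      funext x
      rw [hprodT]
      ring

end Forest

/-! ### Second moments of averaged perturbations -/

section Averages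

variable {Ω : Type*} [MeasurableSpace Ω] {μ : Measure Ω}

lemma indepFun_of_forall_ne {ι κ κ' : Type*} [Fintype κ] [Fintype κ'] {f : ι → Ω → ℝ}
    (hind : iIndepFun f μ) (hf : ∀ i, Measurable (f i)) {u : κ → ι} {u' : κ' → ι}
    (h : ∀ a b, u a ≠ u' b) :
    IndepFun (fun ω a => f (u a) ω) (fun ω b => f (u' b) ω) μ := by
  classical
  have hdisj : Disjoint (Finset.univ.image u) (Finset.univ.image u') := by
    rw [Finset.disjoint_left]
    simp only [Finset.mem_image, Finset.mem_univ, true_and, not_exists, forall_exists_index,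
      forall_apply_eq_imp_iff]
    exact fun a b hab => h a b hab.symm
  exact (hind.indepFun_finset _ _ hdisj hf).comp
    (φ := fun (x : ↥(Finset.univ.image u) → ℝ) a =>
      x ⟨u a, Finset.mem_image_of_mem u (Finset.mem_univ a)⟩)
    (ψ := fun (x : ↥(Finset.univ.image u') → ℝ) b =>
      x ⟨u' b, Finset.mem_image_of_mem u' (Finset.mem_univ b)⟩)
    (measurable_pi_lambda _ fun a => measurable_pi_apply _)
    (measurable_pi_lambda _ fun b => measurable_pi_apply _)

variable [IsProbabilityMeasure μ]

/-- The second moment of an average of pairwise independent zero-mean Gumbel variables. -/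
lemma integral_sq_average {J : Type*} [Fintype J] {Y : J → Ω → ℝ}
    (hY : ∀ j, IsZeroMeanGumbel μ (Y j)) (hind : Pairwise fun i j => IndepFun (Y i) (Y j) μ) :
    MemLp (fun ω => (∑ j, Y j ω) / Fintype.card J) 2 μ ∧
      ∫ ω, ((∑ j, Y j ω) / Fintype.card J) ^ 2 ∂μ = Real.pi ^ 2 / 6 / Fintype.card J := by
  have hL : ∀ j ∈ Finset.univ, MemLp (Y j) 2 μ := fun j _ => (hY j).memLp_two
  have hsum : MemLp (∑ j, Y j) 2 μ := memLp_finsetSum' _ hL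
  have hE : μ[∑ j, Y j] = 0 := by
    simp only [Finset.sum_apply]
    rw [integral_finsetSum _ fun j hj => (hL j hj).integrable (by norm_num)]
    exact Finset.sum_eq_zero fun j _ => (hY j).integral_eq_zero
  have hvar : ∀ j, Var[Y j; μ] = Real.pi ^ 2 / 6 := fun j => by
    rw [variance_of_integral_eq_zero (hY j).1.aemeasurable (hY j).integral_eq_zero]
    exact (hY j).integral_sq
  have hV := IndepFun.variance_sum hL (fun i _ j _ hij => hind hij)
  rw [variance_of_integral_eq_zero hsum.aemeasurable hE] at hV
  simp only [Finset.sum_apply, hvar, Finset.sum_const, Finset.card_univ,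
    nsmul_eq_mul] at hV
  constructor
  · have := hsum.mul_const (Fintype.card J : ℝ)⁻¹
    simpa [div_eq_mul_inv] using this
  · simp only [div_pow]
    rw [integral_div, hV]
    rcases eq_or_ne (Fintype.card J : ℝ) 0 with h | h
    · simp [h]
    · field_simp

/-- Markov's inequality for the square of a sum, combined with the Cauchy–Schwarz inequality. -/
lemma measureReal_le_sum {ι : Type*} (S : Finset ι) {D : ι → Ω → ℝ} {v : ι → ℝ}
    (hint : ∀ e ∈ S, Integrable (fun ω => D e ω ^ 2) μ)
    (hv : ∀ e ∈ S, ∫ ω, D e ω ^ 2 ∂μ ≤ v e) {d : ℝ} (hd : 0 < d) :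
    μ.real {ω | d ≤ ∑ e ∈ S, D e ω} ≤ S.card * (∑ e ∈ S, v e) / d ^ 2 := by
  have hint' : Integrable (fun ω => S.card * ∑ e ∈ S, D e ω ^ 2) μ :=
    (integrable_finsetSum _ hint).const_mul _
  have hmarkov := mul_meas_ge_le_integral_of_nonneg
    (f := fun ω => (S.card : ℝ) * ∑ e ∈ S, D e ω ^ 2)
    (Filter.Eventually.of_forall fun ω => by positivity) hint' (d ^ 2)
  rw [le_div_iff₀ (by positivity), mul_comm]
  calc d ^ 2 * μ.real {ω | d ≤ ∑ e ∈ S, D e ω}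
      ≤ d ^ 2 * μ.real {ω | d ^ 2 ≤ S.card * ∑ e ∈ S, D e ω ^ 2} := by
        refine mul_le_mul_of_nonneg_left (measureReal_mono fun ω hω => ?_) (by positivity)
        exact (pow_le_pow_left₀ hd.le hω 2).trans sq_sum_le_card_mul_sum_sq
    _ ≤ ∫ ω, S.card * ∑ e ∈ S, D e ω ^ 2 ∂μ := hmarkov
    _ = S.card * ∑ e ∈ S, ∫ ω, D e ω ^ 2 ∂μ := by
        rw [integral_const_mul, integral_finsetSum _ hint]
    _ ≤ _ := by
        gcongr with e he
        exact hv e he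

end Averages

namespace PairwiseModel

variable {V : Type*} {X : V → Type*} (M : PairwiseModel V X) (m : V → ℕ)

/-- The average perturbation of the edge `e` when all copies of its endpoints take the
values `q`. -/
noncomputable def constNoise (g : M.NoiseIndex m → ℝ) (e : M.edges) (q : X e.1.1 × X e.1.2) : ℝ :=
  (∑ k : Fin (m e.1.1), ∑ l : Fin (m e.1.2), g ⟨e, (k, l), q⟩) /
    ((m e.1.1 : ℝ) * (m e.1.2 : ℝ))

/-- The average over all pairs of copies of the largest perturbed value of `log p`, centred. -/
noncomputable def maxNoise [∀ i, Fintype (X i)] (p : ∀ e : V × V, X e.1 → X e.2 → ℝ)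
    (g : M.NoiseIndex m → ℝ) (e : M.edges) : ℝ :=
  (∑ k : Fin (m e.1.1), ∑ l : Fin (m e.1.2),
    (logMaxExp (fun q : X e.1.1 × X e.1.2 => p e q.1 q.2) (fun q => g ⟨e, (k, l), q⟩) -
      Real.log (∑ q : X e.1.1 × X e.1.2, p e q.1 q.2))) /
    ((m e.1.1 : ℝ) * (m e.1.2 : ℝ))

/-- The random fluctuation that the edge `e` contributes to the comparison of the perturbed
maxima with the marginals: the first term enters the lower bound of the maxima, the second one
the upper bound. -/
noncomputable def edgeDeviation [∀ i, Fintype (X i)] (p : ∀ e : V × V, X e.1 → X e.2 → ℝ)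
    (Q : ∀ e : V × V, Finset (X e.1 × X e.2)) (g : M.NoiseIndex m → ℝ) (e : M.edges) : ℝ :=
  √(∑ q ∈ Q e, M.constNoise m g e q ^ 2) + |M.maxNoise m p g e|

variable {M m} {Ω : Type*} [MeasurableSpace Ω] {μ : Measure Ω} [IsProbabilityMeasure μ]
  {γ : M.NoiseIndex m → Ω → ℝ}

lemma integral_constNoise_sq (hind : iIndepFun γ μ) (hγ : ∀ q, IsZeroMeanGumbel μ (γ q))
    (e : M.edges) (q : X e.1.1 × X e.1.2) :
    MemLp (fun ω => M.constNoise m (fun i => γ i ω) e q) 2 μ ∧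
      ∫ ω, M.constNoise m (fun i => γ i ω) e q ^ 2 ∂μ =
        Real.pi ^ 2 / 6 / ((m e.1.1 : ℝ) * (m e.1.2 : ℝ)) := by
  have := integral_sq_average (μ := μ)
    (Y := fun kl : Fin (m e.1.1) × Fin (m e.1.2) => γ ⟨e, kl, q⟩) (fun _ => hγ _)
    (fun kl kl' h => hind.indepFun fun h' => h (by simpa using h'))
  simpa [constNoise, Fintype.sum_prod_type] using this

lemma integral_maxNoise_sq [∀ i, Fintype (X i)] (hind : iIndepFun γ μ)
    (hγ : ∀ q, IsZeroMeanGumbel μ (γ q))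
    {p : ∀ e : V × V, X e.1 → X e.2 → ℝ} {e : M.edges} (hp : ∀ a b, 0 ≤ p e a b)
    (hp1 : 0 < ∑ a, ∑ b, p e a b) :
    MemLp (fun ω => M.maxNoise m p (fun i => γ i ω) e) 2 μ ∧
      ∫ ω, M.maxNoise m p (fun i => γ i ω) e ^ 2 ∂μ =
        Real.pi ^ 2 / 6 / ((m e.1.1 : ℝ) * (m e.1.2 : ℝ)) := by
  set w : X e.1.1 × X e.1.2 → ℝ := fun q => p e q.1 q.2
  have hw : 0 < ∑ q, w q := by rwa [Fintype.sum_prod_type]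
  have := integral_sq_average (μ := μ)
    (Y := fun (kl : Fin (m e.1.1) × Fin (m e.1.2)) ω =>
      logMaxExp w (fun q => γ ⟨e, kl, q⟩ ω) - Real.log (∑ q, w q))
    (fun kl => isZeroMeanGumbel_logMaxExp
      (hind.precomp (g := fun q => (⟨e, kl, q⟩ : M.NoiseIndex m)) fun q q' h => by simpa using h)
      (fun q => hγ _) (fun q => hp _ _) hw)
    (fun kl kl' h => (indepFun_of_forall_ne hind (fun q => (hγ q).1)
      (u := fun q => (⟨e, kl, q⟩ : M.NoiseIndex m)) (u' := fun q => ⟨e, kl', q⟩)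
      fun a b h' => h (by simp at h'; exact h'.1)).comp
        ((measurable_logMaxExp w).sub_const _) ((measurable_logMaxExp w).sub_const _))
  have hJ : (Fintype.card (Fin (m e.1.1) × Fin (m e.1.2)) : ℝ) = m e.1.1 * m e.1.2 := by simp
  simpa only [maxNoise, Fintype.sum_prod_type, hJ] using this

lemma integral_edgeDeviation_sq_le [∀ i, Fintype (X i)] (hind : iIndepFun γ μ)
    (hγ : ∀ q, IsZeroMeanGumbel μ (γ q))
    {p : ∀ e : V × V, X e.1 → X e.2 → ℝ} {Q : ∀ e : V × V, Finset (X e.1 × X e.2)}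
    {e : M.edges} (hp : ∀ a b, 0 ≤ p e a b) (hp1 : 0 < ∑ a, ∑ b, p e a b) {c : ℕ}
    (hQ : (Q e).card ≤ c) :
    Integrable (fun ω => M.edgeDeviation m p Q (fun i => γ i ω) e ^ 2) μ ∧
      ∫ ω, M.edgeDeviation m p Q (fun i => γ i ω) e ^ 2 ∂μ ≤
        2 * (c + 1) * (Real.pi ^ 2 / 6) / ((m e.1.1 : ℝ) * (m e.1.2 : ℝ)) := by
  have hc := fun q => integral_constNoise_sq hind hγ e q
  have hm := integral_maxNoise_sq hind hγ hp hp1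
  have hcs : Integrable (fun ω => ∑ q ∈ Q e, M.constNoise m (fun i => γ i ω) e q ^ 2) μ :=
    integrable_finsetSum _ fun q _ => (hc q).1.integrable_sq
  have hbound : Integrable (fun ω => 2 * (∑ q ∈ Q e, M.constNoise m (fun i => γ i ω) e q ^ 2 +
      M.maxNoise m p (fun i => γ i ω) e ^ 2)) μ := (hcs.add hm.1.integrable_sq).const_mul 2
  have hle : ∀ ω, M.edgeDeviation m p Q (fun i => γ i ω) e ^ 2 ≤
      2 * (∑ q ∈ Q e, M.constNoise m (fun i => γ i ω) e q ^ 2 +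
        M.maxNoise m p (fun i => γ i ω) e ^ 2) := fun ω => by
    have h0 : 0 ≤ ∑ q ∈ Q e, M.constNoise m (fun i => γ i ω) e q ^ 2 :=
      Finset.sum_nonneg fun q _ => sq_nonneg _
    have := add_sq_le (a := √(∑ q ∈ Q e, M.constNoise m (fun i => γ i ω) e q ^ 2))
      (b := |M.maxNoise m p (fun i => γ i ω) e|)
    rwa [Real.sq_sqrt h0, sq_abs] at this
  have hmeas : AEStronglyMeasurable
      (fun ω => M.edgeDeviation m p Q (fun i => γ i ω) e ^ 2) μ := by
    refine AEStronglyMeasurable.pow (AEStronglyMeasurable.add ?_ ?_) 2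
    · exact Real.continuous_sqrt.comp_aestronglyMeasurable hcs.aestronglyMeasurable
    · exact continuous_abs.comp_aestronglyMeasurable hm.1.aestronglyMeasurable
  have hint := hbound.mono' hmeas (Filter.Eventually.of_forall fun ω => by
    rw [Real.norm_of_nonneg (sq_nonneg _)]
    exact hle ω)
  refine ⟨hint, (integral_mono hint hbound hle).trans ?_⟩
  rw [integral_const_mul, integral_add hcs hm.1.integrable_sq, hm.2,
    integral_finsetSum _ fun q _ => (hc q).1.integrable_sq]
  simp only [(hc _).2, Finset.sum_const, nsmul_eq_mul]
  have hB : 0 ≤ Real.pi ^ 2 / 6 / ((m e.1.1 : ℝ) * (m e.1.2 : ℝ)) := by positivity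
  have hcard : ((Q e).card : ℝ) ≤ c := by exact_mod_cast hQ
  calc _ = 2 * ((Q e).card + 1) * (Real.pi ^ 2 / 6 / ((m e.1.1 : ℝ) * (m e.1.2 : ℝ))) := by ring
    _ ≤ 2 * (c + 1) * (Real.pi ^ 2 / 6 / ((m e.1.1 : ℝ) * (m e.1.2 : ℝ))) := by gcongr
    _ = _ := by ring

end PairwiseModel

/-! ### Potentials in exponential form -/

/-- The real-valued exponential of an extended real, with `exp (-∞) = 0`. It is meant for
arguments other than `∞`, where it takes the junk value `0`. -/
noncomputable def realExp (x : EReal) : ℝ := (EReal.exp x).toReal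

lemma realExp_nonneg (x : EReal) : 0 ≤ realExp x := ENNReal.toReal_nonneg

@[simp] lemma realExp_coe (x : ℝ) : realExp x = Real.exp x := by
  simp [realExp, (Real.exp_pos x).le]

@[simp] lemma realExp_bot : realExp ⊥ = 0 := by simp [realExp]

lemma realExp_add (x y : EReal) : realExp (x + y) = realExp x * realExp y := by
  simp [realExp, EReal.exp_add]

lemma realExp_sum {ι : Type*} (S : Finset ι) (f : ι → EReal) :
    realExp (∑ i ∈ S, f i) = ∏ i ∈ S, realExp (f i) := by
  classical
  induction S using Finset.induction_on with
  | empty => simp [realExp]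
  | insert i S hi ih => rw [Finset.sum_insert hi, Finset.prod_insert hi, realExp_add, ih]

lemma realExp_coe_mul (t : ℝ) (x : EReal) : realExp (t * x) = realExp x ^ t := by
  rw [realExp, mul_comm, EReal.exp_mul, ← ENNReal.toReal_rpow, realExp]

lemma ofReal_realExp {x : EReal} (hx : x ≠ ⊤) : ENNReal.ofReal (realExp x) = EReal.exp x :=
  ENNReal.ofReal_toReal (by simpa using hx)

lemma realExp_le_realExp_iff {x y : EReal} (hx : x ≠ ⊤) (hy : y ≠ ⊤) :
    realExp x ≤ realExp y ↔ x ≤ y := by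
  rw [realExp, realExp, ENNReal.toReal_le_toReal (by simpa using hx) (by simpa using hy),
    EReal.exp_le_exp_iff]

lemma EReal.sum_ne_top_of_forall {ι : Type*} {S : Finset ι} {f : ι → EReal}
    (h : ∀ i ∈ S, f i ≠ ⊤) : ∑ i ∈ S, f i ≠ ⊤ := by
  classical
  induction S using Finset.induction_on with
  | empty => simp
  | insert i S hi ih =>
    rw [Finset.sum_insert hi]
    exact EReal.add_ne_top (h i (Finset.mem_insert_self i S))
      (ih fun j hj => h j (Finset.mem_insert_of_mem hj))

namespace PairwiseModel

variable {V : Type*} [Fintype V] {X : V → Type*} (M : PairwiseModel V X)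

lemma potential_ne_top (x : ∀ i, X i) : M.potential x ≠ ⊤ :=
  EReal.add_ne_top (EReal.sum_ne_top_of_forall fun i _ => M.nodePot_ne_top i _)
    (EReal.sum_ne_top_of_forall fun _ _ => M.edgePot_ne_top _ _ _ _)

/-- The unnormalized Gibbs weight `exp θ(x)` of an assignment. -/
noncomputable def weight (x : ∀ i, X i) : ℝ := realExp (M.potential x)

lemma weight_nonneg (x : ∀ i, X i) : 0 ≤ M.weight x := realExp_nonneg _

lemma weight_eq (x : ∀ i, X i) : M.weight x = (∏ i, realExp (M.nodePot i (x i))) *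
    ∏ e ∈ M.edges, realExp (M.edgePot e.1 e.2 (x e.1) (x e.2)) := by
  rw [weight, potential, realExp_add, realExp_sum, realExp_sum]

lemma exp_potential (x : ∀ i, X i) :
    EReal.exp (M.potential x) = ENNReal.ofReal (M.weight x) :=
  (ofReal_realExp (M.potential_ne_top x)).symm

lemma weight_pos {x : ∀ i, X i} (hx : M.potential x ≠ ⊥) : 0 < M.weight x := by
  rw [← ENNReal.ofReal_pos, ← exp_potential]
  exact pos_iff_ne_zero.2 (by simpa using hx)

variable [DecidableEq V] {m : V → ℕ}

/-- The exponential of the extended potential. -/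
noncomputable def extWeight (x : ExtAssignment X m) : ℝ := realExp (M.extPotential m x)

lemma extPotential_ne_top (x : ExtAssignment X m) : M.extPotential m x ≠ ⊤ := by
  have h : ∑ k : (∀ i, Fin (m i)), M.potential (fun i => x i (k i)) ≠ ⊤ :=
    EReal.sum_ne_top_of_forall fun k _ => M.potential_ne_top _
  rw [extPotential, EReal.mul_ne_top]
  have : (0 : ℝ) ≤ (∏ i, (m i : ℝ))⁻¹ := by positivity
  refine ⟨by simp, Or.inl (by exact_mod_cast this), by simp, Or.inr h⟩

lemma extWeight_nonneg (x : ExtAssignment X m) : 0 ≤ M.extWeight x := realExp_nonneg _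

/-- The extended weight is the geometric mean of the weights of the selections of one copy of each
variable. -/
lemma extWeight_eq (x : ExtAssignment X m) : M.extWeight x =
    (∏ k : (∀ i, Fin (m i)), M.weight fun i => x i (k i)) ^ ((∏ i, (m i : ℝ))⁻¹) := by
  rw [extWeight, extPotential, realExp_coe_mul, realExp_sum]
  rfl

lemma extWeight_const (hm : ∀ i, 0 < m i) (x : ∀ i, X i) :
    M.extWeight (fun i (_ : Fin (m i)) => x i) = M.weight x := by
  have hpos : (0 : ℝ) < ∏ i, (m i : ℝ) := Finset.prod_pos fun i _ => by exact_mod_cast hm i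
  have hcard : (Fintype.card (∀ i, Fin (m i)) : ℝ) = ∏ i, (m i : ℝ) := by
    simp [Fintype.card_pi]
  rw [extWeight_eq, Finset.prod_const, Finset.card_univ, ← Real.rpow_natCast, hcard,
    ← Real.rpow_mul (M.weight_nonneg x), mul_inv_cancel₀ hpos.ne', Real.rpow_one]

section Marginal

variable [∀ i, Fintype (X i)]

open Classical in
/-- The unnormalized Gibbs marginal of `(x_r, x_s) = (a, b)`. -/
noncomputable def marginal (r s : V) (a : X r) (b : X s) : ℝ :=
  ∑ x with x r = a ∧ x s = b, M.weight x

lemma marginal_nonneg (r s : V) (a : X r) (b : X s) : 0 ≤ M.marginal r s a b :=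
  Finset.sum_nonneg fun x _ => M.weight_nonneg x

lemma sum_marginal (r s : V) :
    ∑ q : X r × X s, M.marginal r s q.1 q.2 = ∑ x, M.weight x := by
  classical
  rw [← Finset.sum_fiberwise Finset.univ (fun x : ∀ i, X i => (x r, x s)) M.weight]
  refine Finset.sum_congr rfl fun q _ => ?_
  simp only [marginal, Prod.ext_iff]

lemma gibbsMarginal_eq (hdom : ∃ x : ∀ i, X i, M.potential x ≠ ⊥) (r s : V) (a : X r) (b : X s) :
    M.gibbsMarginal r s a b =
      ENNReal.ofReal (M.marginal r s a b / ∑ q : X r × X s, M.marginal r s q.1 q.2) := by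
  classical
  obtain ⟨x₀, hx₀⟩ := hdom
  have hpos : 0 < ∑ x, M.weight x :=
    Finset.sum_pos' (fun x _ => M.weight_nonneg x) ⟨x₀, Finset.mem_univ _, M.weight_pos hx₀⟩
  have hZ : M.partitionFunction = ENNReal.ofReal (∑ x, M.weight x) := by
    rw [partitionFunction, ENNReal.ofReal_sum_of_nonneg fun x _ => M.weight_nonneg x]
    exact Finset.sum_congr rfl fun x _ => M.exp_potential x
  rw [sum_marginal, ENNReal.ofReal_div_of_pos hpos, ← hZ, marginal,
    ENNReal.ofReal_sum_of_nonneg fun x _ => M.weight_nonneg x, gibbsMarginal,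
    ← Finset.sum_filter, div_eq_mul_inv, Finset.sum_mul]
  refine Finset.sum_congr (by congr) fun x _ => ?_
  rw [gibbs, exp_potential, div_eq_mul_inv]

lemma sumOver_weight (r s : V) (x : ∀ i, X i) :
    sumOver ((Finset.univ.erase r).erase s) M.weight x = M.marginal r s (x r) (x s) := by
  classical
  rw [sumOver, marginal]
  refine Finset.sum_congr ?_ fun _ _ => rfl
  ext y
  simp only [Finset.mem_filter, Finset.mem_univ, true_and, Finset.mem_erase, not_and]
  constructor
  · exact fun h => ⟨h r (by tauto), h s (by tauto)⟩
  · rintro ⟨h1, h2⟩ i hi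
    by_cases his : i = s
    · subst his; exact h2
    · by_cases hir : i = r
      · subst hir; exact h1
      · simp [his, hir] at hi

/-- The local bounds for the Gibbs weights of a model on a forest. -/
lemma nonempty_forestBounds_weight [∀ i, Nonempty (X i)] (hG : M.graph.IsAcyclic) {r s : V}
    (hrs : (r, s) ∈ M.edges) {c : ℕ} (hc : ∀ i, Fintype.card (X i) ≤ c) :
    Nonempty (ForestBounds c (M.edges.erase (r, s)) ((Finset.univ.erase r).erase s) M.weight) := by
  have hne : ∀ e ∈ M.edges, e.1 ≠ e.2 := fun e he h => by
    obtain ⟨p, q⟩ := e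
    obtain rfl : p = q := h
    exact M.asymm p p he he
  have hadj : ∀ e ∈ M.edges, M.graph.Adj e.1 e.2 := fun e he =>
    (SimpleGraph.fromRel_adj _ _ _).2 ⟨hne e he, Or.inl he⟩
  have := nonempty_forestBounds hG (hadj _ hrs) hc
    (φ := fun e a b => realExp (M.edgePot e.1 e.2 a b)) (fun _ _ _ => realExp_nonneg _)
    ((Finset.univ.erase r).erase s) (by simp) (by simp) Finset.univ (M.edges.erase (r, s))
    (fun a b => realExp (M.edgePot r s a b)) (fun i a => realExp (M.nodePot i a))
    (fun _ _ => realExp_nonneg _) (fun _ _ => realExp_nonneg _)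
    (fun i => by simp only [Finset.mem_univ, Finset.mem_erase, true_iff]; tauto)
    (fun e he => by
      obtain ⟨he1, he2⟩ := Finset.mem_erase.1 he
      refine ⟨hadj e he2, Finset.mem_univ _, Finset.mem_univ _,
        fun h => M.asymm e.1 e.2 he2 (Finset.mem_of_mem_erase h), ?_⟩
      simp only [Finset.mem_erase, Finset.mem_univ, and_true]
      by_contra hcon
      obtain ⟨p, q⟩ := e
      have hpq := hne _ he2
      have hsr : (s, r) ∉ M.edges := M.asymm r s hrs
      simp only [ne_eq, not_or, not_and, not_not, Prod.mk.injEq] at hcon hpq he1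
      by_cases hp : p = s
      · subst hp
        obtain rfl := hcon.2 (Ne.symm hpq)
        exact hsr he2
      · obtain rfl := hcon.1 hp
        by_cases hq : q = s
        · exact he1 rfl hq
        · exact hpq (hcon.2 hq).symm)
  convert this using 2
  funext x
  rw [weight_eq, ← Finset.mul_prod_erase M.edges _ hrs]
  ring

end Marginal

end PairwiseModel

/-! ### Perturbed maxima and marginals -/

/-- Summing over a redundant replacement of one coordinate. -/
lemma sum_sum_update {V : Type*} [Fintype V] [DecidableEq V] {κ : V → Type*}
    [∀ i, Fintype (κ i)] (i : V) (G : (∀ i, κ i) → ℝ) :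
    ∑ k, ∑ a, G (Function.update k i a) = Fintype.card (κ i) * ∑ k, G k := by
  calc ∑ k, ∑ a, G (Function.update k i a)
      = ∑ z : (∀ i, κ i) × κ i, G (Function.update z.1 i z.2) := by
        rw [Fintype.sum_prod_type]
    _ = ∑ z : (∀ i, κ i) × κ i, G z.1 := by
        refine Finset.sum_bij' (fun z _ => (Function.update z.1 i z.2, z.1 i))
          (fun z _ => (Function.update z.1 i z.2, z.1 i)) ?_ ?_ ?_ ?_ ?_ <;> simp
    _ = _ := by
        rw [Fintype.sum_prod_type]
        simp [Finset.mul_sum]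

/-- The average over all choice functions of a function of two coordinates. -/
lemma average_two_coordinates {V : Type*} [Fintype V] [DecidableEq V] {m : V → ℕ}
    (hm : ∀ i, 0 < m i) {i j : V} (hij : i ≠ j) (h : Fin (m i) → Fin (m j) → ℝ) :
    (∏ t, (m t : ℝ))⁻¹ * ∑ k : (∀ t, Fin (m t)), h (k i) (k j) =
      (∑ a, ∑ b, h a b) / ((m i : ℝ) * (m j : ℝ)) := by
  have hpos : (0 : ℝ) < ∏ i, (m i : ℝ) := Finset.prod_pos fun i _ => by exact_mod_cast hm i
  have hi : (0 : ℝ) < m i := by exact_mod_cast hm i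
  have hj : (0 : ℝ) < m j := by exact_mod_cast hm j
  have h1 := sum_sum_update (κ := fun t => Fin (m t)) i
    fun k => ∑ b, h (Function.update k j b i) (Function.update k j b j)
  have h2 := sum_sum_update (κ := fun t => Fin (m t)) j fun k => h (k i) (k j)
  rw [h2] at h1
  simp only [Function.update_of_ne hij, Function.update_self, Finset.sum_const,
    Finset.card_univ, Fintype.card_pi, Fintype.card_fin, nsmul_eq_mul, Nat.cast_prod] at h1
  field_simp
  linarith

namespace PairwiseModel

lemma ne_of_mem_edges {V : Type*} {X : V → Type*} (M : PairwiseModel V X)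
    {e : V × V} (he : e ∈ M.edges) : e.1 ≠ e.2 := fun h => by
  obtain ⟨p, q⟩ := e
  obtain rfl : p = q := h
  exact M.asymm p p he he

lemma exists_assignment {V : Type*} [DecidableEq V] {X : V → Type*} [∀ i, Nonempty (X i)] {r s : V}
    (hrs : r ≠ s) (a : X r) (b : X s) :
    ∃ x : ∀ i, X i, x r = a ∧ x s = b := by
  let x₀ : ∀ i, X i := fun i => Classical.arbitrary _
  exact ⟨Function.update (Function.update x₀ r a) s b, by simp [hrs], by simp⟩

variable {V : Type*} [DecidableEq V] {X : V → Type*} (M : PairwiseModel V X) {m : V → ℕ}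

/-- The edges other than `(r, s)`. -/
def otherEdges (r s : V) : Finset M.edges := Finset.univ.filter fun e => (e : V × V) ≠ (r, s)

lemma mem_erase_of_mem_otherEdges {r s : V} {e : M.edges} (he : e ∈ M.otherEdges r s) :
    (e : V × V) ∈ M.edges.erase (r, s) :=
  Finset.mem_erase.2 ⟨(Finset.mem_filter.1 he).2, e.2⟩

lemma map_otherEdges (r s : V) :
    (M.otherEdges r s).map (Function.Embedding.subtype _) = M.edges.erase (r, s) := by
  ext e
  simp only [otherEdges, Finset.mem_map, Finset.mem_filter, Finset.mem_univ, true_and,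
    Function.Embedding.coe_subtype, Finset.mem_erase]
  constructor
  · rintro ⟨e, he, rfl⟩
    exact ⟨he, e.2⟩
  · exact fun h => ⟨⟨e, h.2⟩, h.1, rfl⟩

lemma prod_otherEdges (r s : V) (f : V × V → ℝ) :
    ∏ e ∈ M.edges.erase (r, s), f e = ∏ e ∈ M.otherEdges r s, f e := by
  rw [← map_otherEdges, Finset.prod_map]
  rfl

lemma sum_otherEdges (r s : V) (f : V × V → ℝ) :
    ∑ e ∈ M.edges.erase (r, s), f e = ∑ e ∈ M.otherEdges r s, f e := by
  rw [← map_otherEdges, Finset.sum_map]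
  rfl

/-- The average perturbation of the edge `e` at an extended assignment. -/
noncomputable def edgeNoise (g : M.NoiseIndex m → ℝ) (x : ExtAssignment X m) (e : M.edges) : ℝ :=
  (∑ k : Fin (m e.1.1), ∑ l : Fin (m e.1.2), g ⟨e, (k, l), (x e.1.1 k, x e.1.2 l)⟩) /
      ((m e.1.1 : ℝ) * (m e.1.2 : ℝ))

/-- The total perturbation of the edges other than `(r, s)`. -/
noncomputable def restNoise (r s : V) (g : M.NoiseIndex m → ℝ) (x : ExtAssignment X m) : ℝ :=
  ∑ e ∈ M.otherEdges r s, M.edgeNoise g x e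

variable [Fintype V]

/-- The exponential of the largest value, among the extended assignments with `(x_r, x_s) = (a, b)`,
of the extended potential perturbed on the edges other than `(r, s)`. -/
noncomputable def maxWeight (m : V → ℕ) (r s : V) (g : M.NoiseIndex m → ℝ) (a : X r) (b : X s) :
    ℝ :=
  ⨆ x : {x : ExtAssignment X m // (∀ k, x r k = a) ∧ ∀ k, x s k = b},
    M.extWeight x.1 * Real.exp (M.restNoise r s g x.1)

lemma maxWeight_nonneg {r s : V} (g : M.NoiseIndex m → ℝ) (a : X r) (b : X s) :
    0 ≤ M.maxWeight m r s g a b :=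
  Real.iSup_nonneg fun _ => mul_nonneg (M.extWeight_nonneg _) (Real.exp_pos _).le

variable [∀ i, Fintype (X i)]

lemma le_maxWeight {r s : V} (g : M.NoiseIndex m → ℝ) {a : X r} {b : X s}
    {x : ExtAssignment X m} (ha : ∀ k, x r k = a) (hb : ∀ k, x s k = b) :
    M.extWeight x * Real.exp (M.restNoise r s g x) ≤ M.maxWeight m r s g a b :=
  le_ciSup (f := fun x : {x : ExtAssignment X m // (∀ k, x r k = a) ∧ ∀ k, x s k = b} =>
    M.extWeight x.1 * Real.exp (M.restNoise r s g x.1)) (Set.finite_range _).bddAbove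
    ⟨x, ha, hb⟩

/-- The maximum in the definition of `maxWeight` is attained. -/
lemma exists_eq_maxWeight [∀ i, Nonempty (X i)] {r s : V} (hrs : r ≠ s)
    (g : M.NoiseIndex m → ℝ) (a : X r) (b : X s) :
    ∃ x : ExtAssignment X m, (∀ k, x r k = a) ∧ (∀ k, x s k = b) ∧
      M.extWeight x * Real.exp (M.restNoise r s g x) = M.maxWeight m r s g a b := by
  obtain ⟨y, hy⟩ := exists_assignment hrs a b
  have : Nonempty {x : ExtAssignment X m // (∀ k, x r k = a) ∧ ∀ k, x s k = b} :=
    ⟨⟨fun i _ => y i, fun _ => hy.1, fun _ => hy.2⟩⟩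
  obtain ⟨x, hx⟩ := exists_eq_ciSup_of_finite
    (f := fun x : {x : ExtAssignment X m // (∀ k, x r k = a) ∧ ∀ k, x s k = b} =>
      M.extWeight x.1 * Real.exp (M.restNoise r s g x.1))
  exact ⟨x.1, x.2.1, x.2.2, hx⟩

variable {c : ℕ} {r s : V} {M}
  (B : ForestBounds c (M.edges.erase (r, s)) ((Finset.univ.erase r).erase s) M.weight)

/-- The random part of the upper bound of the perturbed maxima by the marginals. -/
noncomputable def upperDeviation {U : Finset V}
    (B : ForestBounds c (M.edges.erase (r, s)) U M.weight) (g : M.NoiseIndex m → ℝ) : ℝ :=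
  ∑ e ∈ M.otherEdges r s, |M.maxNoise m B.factor g e|

/-- The random part of the lower bound of the perturbed maxima by the marginals. -/
noncomputable def lowerDeviation {U : Finset V}
    (B : ForestBounds c (M.edges.erase (r, s)) U M.weight) (g : M.NoiseIndex m → ℝ) : ℝ :=
  ∑ e ∈ M.otherEdges r s, √(∑ q ∈ B.good e, M.constNoise m g e q ^ 2)

lemma card_otherEdges_le
    (B : ForestBounds c (M.edges.erase (r, s)) ((Finset.univ.erase r).erase s) M.weight) :
    (M.otherEdges r s).card ≤ ((Finset.univ.erase r).erase s).card := by
  rw [← Finset.card_map (Function.Embedding.subtype _), map_otherEdges]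
  exact Finset.card_le_card_of_injOn B.child B.child_mem B.child_injOn

/-- The maximum over the copies is at most the average over all selections of one copy of each
variable of the maxima for that selection, and for a single selection the forest factorization
bounds the perturbed maximum by the marginal and one Gumbel maximum for each edge. -/
lemma extWeight_mul_exp_le (hm : ∀ i, 0 < m i)
    (hc1 : 1 ≤ c) (g : M.NoiseIndex m → ℝ) {a : X r} {b : X s}
    {x : ExtAssignment X m} (ha : ∀ k, x r k = a) (hb : ∀ k, x s k = b) :
    M.extWeight x * Real.exp (M.restNoise r s g x) ≤ M.marginal r s a b *
      Real.exp (((Finset.univ.erase r).erase s).card * Real.log c + upperDeviation B g) := by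
  have hcard0 : (0 : ℝ) < ∏ i, (m i : ℝ) :=
    Finset.prod_pos fun i _ => by exact_mod_cast hm i
  by_cases hpos : ∀ k : (∀ i, Fin (m i)), 0 < M.weight fun i => x i (k i)
  swap
  · push Not at hpos
    obtain ⟨k, hk⟩ := hpos
    have h0 : M.extWeight x = 0 := by
      rw [extWeight_eq, Finset.prod_eq_zero (Finset.mem_univ k)
        (le_antisymm hk (M.weight_nonneg _)), Real.zero_rpow (inv_ne_zero hcard0.ne')]
    rw [h0, zero_mul]
    exact mul_nonneg (M.marginal_nonneg _ _ _ _) (Real.exp_pos _).le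
  have hfac : ∀ k : (∀ i, Fin (m i)), 0 < M.marginal r s a b ∧
      (∀ e ∈ M.otherEdges r s, 0 < B.factor e (x e.1.1 (k e.1.1)) (x e.1.2 (k e.1.2))) ∧
      Real.log (M.weight fun i => x i (k i)) ≤ Real.log (M.marginal r s a b) +
        ∑ e ∈ M.otherEdges r s,
          Real.log (B.factor e (x e.1.1 (k e.1.1)) (x e.1.2 (k e.1.2))) := fun k => by
    have h := B.le_prod_factor fun i => x i (k i)
    rw [sumOver_weight, ha, hb, prod_otherEdges M r s
      fun e => B.factor e (x e.1 (k e.1)) (x e.2 (k e.2))] at h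
    have hpos' := (hpos k).trans_le h
    have hprod0 : 0 ≤ ∏ e ∈ M.otherEdges r s,
        B.factor e (x e.1.1 (k e.1.1)) (x e.1.2 (k e.1.2)) :=
      Finset.prod_nonneg fun e he =>
        B.factor_nonneg e (M.mem_erase_of_mem_otherEdges he) _ _
    have hmarg : 0 < M.marginal r s a b := pos_of_mul_pos_left hpos' hprod0
    have hprod := pos_of_mul_pos_right hpos' hmarg.le
    have hne := Finset.prod_ne_zero_iff.1 hprod.ne'
    refine ⟨hmarg, fun e he => lt_of_le_of_ne
      (B.factor_nonneg e (M.mem_erase_of_mem_otherEdges he) _ _) (hne e he).symm, ?_⟩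
    rw [← Real.log_prod hne, ← Real.log_mul hmarg.ne' hprod.ne']
    exact Real.log_le_log (hpos k) h
  obtain ⟨hmarg, -, -⟩ := hfac fun i => ⟨0, hm i⟩
  have hext : M.extWeight x = Real.exp ((∏ i, (m i : ℝ))⁻¹ *
      ∑ k : (∀ i, Fin (m i)), Real.log (M.weight fun i => x i (k i))) := by
    rw [extWeight_eq, Real.rpow_def_of_pos (Finset.prod_pos fun k _ => hpos k),
      Real.log_prod fun k _ => (hpos k).ne', mul_comm]
  have hcardk : (Fintype.card (∀ i, Fin (m i)) : ℝ) = ∏ i, (m i : ℝ) := by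
    simp [Fintype.card_pi]
  have havg : (∏ i, (m i : ℝ))⁻¹ *
      ∑ k : (∀ i, Fin (m i)), Real.log (M.weight fun i => x i (k i)) ≤
      Real.log (M.marginal r s a b) + ∑ e ∈ M.otherEdges r s,
        (∑ k, ∑ l, Real.log (B.factor e (x e.1.1 k) (x e.1.2 l))) /
          ((m e.1.1 : ℝ) * (m e.1.2 : ℝ)) := by
    calc _ ≤ (∏ i, (m i : ℝ))⁻¹ * ∑ k : (∀ i, Fin (m i)), (Real.log (M.marginal r s a b) +
          ∑ e ∈ M.otherEdges r s,
            Real.log (B.factor e (x e.1.1 (k e.1.1)) (x e.1.2 (k e.1.2)))) := by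
          gcongr with k
          exact (hfac k).2.2
      _ = _ := by
          rw [Finset.sum_add_distrib, mul_add]
          congr 1
          · rw [Finset.sum_const, Finset.card_univ, nsmul_eq_mul, hcardk,
              inv_mul_cancel_left₀ hcard0.ne']
          · rw [Finset.sum_comm, Finset.mul_sum]
            exact Finset.sum_congr rfl fun e _ => average_two_coordinates hm
              (M.ne_of_mem_edges e.2) fun k l => Real.log (B.factor e (x e.1.1 k) (x e.1.2 l))
  have hedge : ∀ e ∈ M.otherEdges r s,
      (∑ k, ∑ l, Real.log (B.factor e (x e.1.1 k) (x e.1.2 l))) /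
          ((m e.1.1 : ℝ) * (m e.1.2 : ℝ)) + M.edgeNoise g x e ≤
        Real.log c + |M.maxNoise m B.factor g e| := fun e he => by
    have he' := M.mem_erase_of_mem_otherEdges he
    have hi : (0 : ℝ) < m e.1.1 := by exact_mod_cast hm _
    have hj : (0 : ℝ) < m e.1.2 := by exact_mod_cast hm _
    have hmax : (∑ k, ∑ l, Real.log (B.factor e (x e.1.1 k) (x e.1.2 l))) /
          ((m e.1.1 : ℝ) * (m e.1.2 : ℝ)) + M.edgeNoise g x e ≤
        M.maxNoise m B.factor g e + Real.log (∑ q : X e.1.1 × X e.1.2, B.factor e q.1 q.2) := by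
      rw [edgeNoise, maxNoise, ← add_div, ← Finset.sum_add_distrib]
      simp only [← Finset.sum_add_distrib, Finset.sum_sub_distrib, Finset.sum_const,
        Finset.card_univ, Fintype.card_fin, nsmul_eq_mul]
      rw [← mul_assoc, sub_div, mul_div_cancel_left₀ _ (by positivity), sub_add_cancel]
      gcongr with k _ l _
      refine log_add_le_logMaxExp (fun q : X e.1.1 × X e.1.2 => B.factor e q.1 q.2)
        (fun q => g ⟨e, (k, l), q⟩) (q := (x e.1.1 k, x e.1.2 l)) ?_
      -- A choice function that selects the copies `k` and `l`.
      have hne := M.ne_of_mem_edges e.2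
      have := (hfac (Function.update (Function.update (fun i => ⟨0, hm i⟩) e.1.1 k)
        e.1.2 l)).2.1 e he
      simpa [hne] using this
    have hlog : Real.log (∑ q : X e.1.1 × X e.1.2, B.factor e q.1 q.2) ≤ Real.log c := by
      rw [Fintype.sum_prod_type]
      exact Real.log_le_log (one_pos.trans_le (B.one_le_sum_factor e he'))
        (B.sum_factor_le e he')
    have h1 := le_abs_self (M.maxNoise m B.factor g e)
    linarith
  have hsum := Finset.sum_le_sum hedge
  rw [Finset.sum_add_distrib, Finset.sum_add_distrib, Finset.sum_const, nsmul_eq_mul] at hsum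
  have hlogc : 0 ≤ Real.log c := Real.log_nonneg (by exact_mod_cast hc1)
  have hN : ((M.otherEdges r s).card : ℝ) * Real.log c ≤
      ((Finset.univ.erase r).erase s).card * Real.log c := by
    gcongr
    exact card_otherEdges_le B
  rw [hext, ← Real.exp_add]
  nth_rewrite 1 [← Real.exp_log hmarg]
  rw [← Real.exp_add]
  refine Real.exp_le_exp.2 ?_
  rw [restNoise, upperDeviation]
  linarith

/-- Among the constant extended assignments there is one which attains the marginal up to a
factor and the perturbations of the good pairs. -/
lemma marginal_le_maxWeight (hm : ∀ i, 0 < m i) (hc1 : 1 ≤ c) (hrs : r ≠ s) [∀ i, Nonempty (X i)]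
    (g : M.NoiseIndex m → ℝ) (a : X r) (b : X s) :
    M.marginal r s a b ≤ M.maxWeight m r s g a b *
      Real.exp (((Finset.univ.erase r).erase s).card * Real.log c + lowerDeviation B g) := by
  obtain ⟨z, rfl, rfl⟩ := exists_assignment hrs a b
  obtain ⟨y, hy, hle, hgood⟩ := B.exists_good z
  have hyr : y r = z r := hy r (by simp)
  have hys : y s = z s := hy s (by simp)
  rw [sumOver_weight] at hle
  set x : ExtAssignment X m := fun i _ => y i with hx
  have hmax := M.le_maxWeight g (x := x) (fun _ => hyr) (fun _ => hys)
  rw [hx, extWeight_const M hm, ← hx] at hmax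
  have hdev : -lowerDeviation B g ≤ M.restNoise r s g x := by
    rw [lowerDeviation, restNoise, ← Finset.sum_neg_distrib]
    refine Finset.sum_le_sum fun e he => ?_
    have h1 : M.edgeNoise g x e = M.constNoise m g e (y e.1.1, y e.1.2) := rfl
    have h2 : |M.constNoise m g e (y e.1.1, y e.1.2)| ≤
        √(∑ q ∈ B.good e, M.constNoise m g e q ^ 2) := by
      rw [← Real.sqrt_sq_eq_abs]
      exact Real.sqrt_le_sqrt (Finset.single_le_sum
        (f := fun q => M.constNoise m g e q ^ 2) (fun q _ => sq_nonneg _)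
        (hgood e (M.mem_erase_of_mem_otherEdges he)))
    have h3 := neg_abs_le (M.constNoise m g e (y e.1.1, y e.1.2))
    rw [h1]
    linarith
  have hc0 : (0 : ℝ) < c := by exact_mod_cast hc1
  calc M.marginal r s (z r) (z s)
      ≤ (c : ℝ) ^ ((Finset.univ.erase r).erase s).card * M.weight y := hle
    _ = M.weight y * Real.exp (-lowerDeviation B g) *
        Real.exp (((Finset.univ.erase r).erase s).card * Real.log c + lowerDeviation B g) := by
      rw [mul_assoc, ← Real.exp_add, neg_add_cancel_comm_assoc, ← Real.log_pow,
        Real.exp_log (by positivity), mul_comm]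
    _ ≤ _ := by
      refine mul_le_mul_of_nonneg_right (le_trans ?_ hmax) (Real.exp_pos _).le
      exact mul_le_mul_of_nonneg_left (Real.exp_le_exp.2 hdev) (M.weight_nonneg y)

end PairwiseModel

/-! ### Elementary inequalities -/

/-- Normalizing two families which agree up to factors costs the product of the two factors. -/
lemma div_sum_le_div_sum_mul {I : Type*} [Fintype I] {u v : I → ℝ} {K L : ℝ} (hK : 0 < K)
    (hu : ∀ i, 0 ≤ u i) (huv : ∀ i, u i ≤ v i * K)
    (hvu : ∀ i, v i ≤ u i * L) (hsum : 0 < ∑ i, u i) (i : I) :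
    u i / ∑ j, u j ≤ v i / (∑ j, v j) * (K * L) := by
  have h1 : ∑ j, u j ≤ (∑ j, v j) * K := by
    rw [Finset.sum_mul]
    exact Finset.sum_le_sum fun j _ => huv j
  have h2 : ∑ j, v j ≤ (∑ j, u j) * L := by
    rw [Finset.sum_mul]
    exact Finset.sum_le_sum fun j _ => hvu j
  have hv : 0 < ∑ j, v j := pos_of_mul_pos_left (hsum.trans_le h1) hK.le
  rw [div_mul_eq_mul_div, div_le_div_iff₀ hsum hv]
  have hvi : 0 ≤ v i * K := (hu i).trans (huv i)
  calc u i * ∑ j, v j ≤ (v i * K) * ((∑ j, u j) * L) :=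
        mul_le_mul (huv i) h2 hv.le hvi
    _ = _ := by ring

lemma log_ofReal_le_add {x y t : ℝ} (hy : 0 ≤ y) (h : x ≤ y * Real.exp t) :
    ENNReal.log (ENNReal.ofReal x) ≤ ENNReal.log (ENNReal.ofReal y) + (t : EReal) := by
  have ht : ENNReal.log (ENNReal.ofReal (Real.exp t)) = t := by
    rw [ENNReal.log_ofReal_of_pos (Real.exp_pos t), Real.log_exp]
  calc _ ≤ ENNReal.log (ENNReal.ofReal (y * Real.exp t)) :=
        ENNReal.log_le_log (ENNReal.ofReal_le_ofReal h)
    _ = _ := by rw [ENNReal.ofReal_mul hy, ENNReal.log_mul_add, ht]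

lemma sq_log_le {c : ℝ} (hc : 1 ≤ c) : Real.log c ^ 2 ≤ 3 / 4 * c := by
  have hc0 : 0 < c := by linarith
  have hs : 0 < √c := Real.sqrt_pos.2 hc0
  have he : (2.7 : ℝ) < Real.exp 1 := lt_trans (by norm_num) Real.exp_one_gt_d9
  have h1 : Real.log c = 2 * Real.log √c := by
    rw [Real.log_sqrt hc0.le]; ring
  -- The tangent of the logarithm at `e`.
  have h2 : Real.log √c ≤ √c / Real.exp 1 := by
    have := Real.log_le_sub_one_of_pos (div_pos hs (Real.exp_pos 1))
    rw [Real.log_div hs.ne' (Real.exp_pos 1).ne', Real.log_exp] at this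
    linarith
  have h3 : √c / Real.exp 1 ≤ √c / 2.7 := by gcongr
  have h4 : 0 ≤ Real.log c := Real.log_nonneg hc
  have h5 : Real.log c ≤ 2 * (√c / 2.7) := by linarith
  calc Real.log c ^ 2 ≤ (2 * (√c / 2.7)) ^ 2 := by gcongr
    _ = 4 / 2.7 ^ 2 * √c ^ 2 := by ring
    _ = 4 / 2.7 ^ 2 * c := by rw [Real.sq_sqrt hc0.le]
    _ ≤ 3 / 4 * c := mul_le_mul_of_nonneg_right (by norm_num) hc0.le

/-- The Markov bound for a total deviation of `ε (N + 2) - 2 N ℓ` does not exceed the admissible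
failure probability, provided that the latter is at most one. -/
lemma markov_bound_le {N v ε ℓ c B : ℝ} (hN : 0 ≤ N) (hv : 0 ≤ v) (hε : 0 < ε)
    (hc : 1 ≤ c) (hB : 0 < B) (hℓB : 2 * ℓ ^ 2 ≤ c * B) (h : c * B * (2 + v) ≤ ε ^ 2) :
    0 < ε * (N + 2) - 2 * N * ℓ ∧
      N * (2 * (c + 1) * B * v) / (ε * (N + 2) - 2 * N * ℓ) ^ 2 ≤ c * B * (2 + v) / ε ^ 2 := by
  have hcB : 0 < c * B := by positivity
  have hℓε : 2 * ℓ ^ 2 * (2 + v) ≤ ε ^ 2 :=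
    (mul_le_mul_of_nonneg_right hℓB (by linarith)).trans h
  have h2 : 2 * ℓ ≤ ε := by
    refine abs_le_of_sq_le_sq' ?_ hε.le |>.2
    nlinarith [mul_nonneg (sq_nonneg ℓ) hv]
  have hd : 0 < ε * (N + 2) - 2 * N * ℓ := by nlinarith
  refine ⟨hd, ?_⟩
  rw [div_le_div_iff₀ (by positivity) (by positivity)]
  -- The quadratic form in `ε` and `ℓ` below has discriminant `-16 N ≤ 0`.
  have hq : 0 ≤ (N ^ 2 + 4) * ε ^ 2 - 4 * N * (N + 2) * ℓ * ε + 4 * (N ^ 2 + 4 * N) * ℓ ^ 2 := by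
    have : 0 ≤ ((N ^ 2 + 4) * ε - 2 * N * (N + 2) * ℓ) ^ 2 + 64 * N * ℓ ^ 2 := by positivity
    have h4 : (0 : ℝ) < N ^ 2 + 4 := by positivity
    refine nonneg_of_mul_nonneg_right (a := N ^ 2 + 4) ?_ h4
    nlinarith
  have key : 4 * N * v * ε ^ 2 ≤ (2 + v) * (ε * (N + 2) - 2 * N * ℓ) ^ 2 := by
    have h5 := mul_nonneg (by linarith : 0 ≤ 2 + v) hq
    have h6 := mul_le_mul_of_nonneg_left hℓε (by positivity : 0 ≤ 8 * N)
    nlinarith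
  calc N * (2 * (c + 1) * B * v) * ε ^ 2 = 2 * (c + 1) * B * (N * v * ε ^ 2) := by ring
    _ ≤ 2 * (c + c) * B * (N * v * ε ^ 2) := by gcongr
    _ = c * B * (4 * N * v * ε ^ 2) := by ring
    _ ≤ c * B * ((2 + v) * (ε * (N + 2) - 2 * N * ℓ) ^ 2) := by gcongr
    _ = _ := by ring

/-! ### The conditional distribution of the maximizer -/

namespace PairwiseModel

variable {V : Type*} {X : V → Type*} (M : PairwiseModel V X) {m : V → ℕ} {r s : V}

/-- The index of the perturbation of the labels `q` on the edge `(r, s)`, whose endpoints have a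
single copy. -/
def rootIndex (hrs : (r, s) ∈ M.edges) (hr : m r = 1) (hs : m s = 1) (q : X r × X s) :
    M.NoiseIndex m :=
  ⟨⟨(r, s), hrs⟩, (⟨0, by simp [hr]⟩, ⟨0, by simp [hs]⟩), q⟩

lemma extNoise_eq [DecidableEq V] (hrs : (r, s) ∈ M.edges) (hr : m r = 1) (hs : m s = 1)
    (g : M.NoiseIndex m → ℝ) {x : ExtAssignment X m} {a : X r} {b : X s}
    (ha : ∀ k, x r k = a) (hb : ∀ k, x s k = b) :
    M.extNoise m g x = g (M.rootIndex hrs hr hs (a, b)) + M.restNoise r s g x := by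
  have hroot : M.edgeNoise g x ⟨(r, s), hrs⟩ = g (M.rootIndex hrs hr hs (a, b)) := by
    have : Subsingleton (Fin (m r)) := by rw [hr]; infer_instance
    have : Subsingleton (Fin (m s)) := by rw [hs]; infer_instance
    rw [edgeNoise, Fintype.sum_subsingleton _ (⟨0, by simp [hr]⟩ : Fin (m r)),
      Fintype.sum_subsingleton _ (⟨0, by simp [hs]⟩ : Fin (m s)), ha, hb]
    simp [hr, hs, rootIndex]
  have hother : M.otherEdges r s = Finset.univ.erase ⟨(r, s), hrs⟩ := by
    ext e
    simp [otherEdges, Subtype.ext_iff]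
  rw [restNoise, hother, ← hroot]
  exact (Finset.add_sum_erase _ (M.edgeNoise g x) (Finset.mem_univ _)).symm

lemma mem_mapEvent_iff [Fintype V] [DecidableEq V] [∀ i, Fintype (X i)]
    [∀ i, Nonempty (X i)] (hrs : (r, s) ∈ M.edges) (hr : m r = 1) (hs : m s = 1)
    {Ω : Type*} (γ : M.NoiseIndex m → Ω → ℝ) (a : X r) (b : X s) (ω : Ω) :
    ω ∈ M.mapEvent m γ r s a b ↔ ∀ q : X r × X s,
      M.maxWeight m r s (fun i => γ i ω) q.1 q.2 *
          Real.exp (γ (M.rootIndex hrs hr hs q) ω) ≤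
        M.maxWeight m r s (fun i => γ i ω) a b *
          Real.exp (γ (M.rootIndex hrs hr hs (a, b)) ω) := by
  have hne : r ≠ s := M.ne_of_mem_edges hrs
  set g : M.NoiseIndex m → ℝ := fun i => γ i ω
  have hval : ∀ {x : ExtAssignment X m} {a : X r} {b : X s}, (∀ k, x r k = a) →
      (∀ k, x s k = b) → realExp (M.extPotential m x + (M.extNoise m g x : EReal)) =
        M.extWeight x * Real.exp (M.restNoise r s g x) *
          Real.exp (g (M.rootIndex hrs hr hs (a, b))) := fun ha hb => by
    rw [realExp_add, realExp_coe, M.extNoise_eq hrs hr hs g ha hb, Real.exp_add, extWeight]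
    ring
  have htop : ∀ x : ExtAssignment X m,
      M.extPotential m x + (M.extNoise m g x : EReal) ≠ ⊤ := fun x =>
    EReal.add_ne_top (M.extPotential_ne_top x) (EReal.coe_ne_top _)
  constructor
  · rintro ⟨x, hx, ha, hb⟩ q
    obtain ⟨y, hya, hyb, hy⟩ := M.exists_eq_maxWeight hne g q.1 q.2
    have h := (realExp_le_realExp_iff (htop y) (htop x)).2 (hx (Set.mem_univ y))
    rw [hval hya hyb, hval ha hb, hy] at h
    exact h.trans (mul_le_mul_of_nonneg_right (M.le_maxWeight g ha hb) (Real.exp_pos _).le)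
  · intro h
    obtain ⟨x, hxa, hxb, hx⟩ := M.exists_eq_maxWeight hne g a b
    refine ⟨x, fun y _ => ?_, hxa, hxb⟩
    rw [Set.mem_ofPred_eq, ← realExp_le_realExp_iff (htop y) (htop x)]
    have hya : ∀ k, y r k = y r ⟨0, by simp [hr]⟩ := fun k => by
      have : Subsingleton (Fin (m r)) := by rw [hr]; infer_instance
      rw [Subsingleton.elim k]
    have hyb : ∀ k, y s k = y s ⟨0, by simp [hs]⟩ := fun k => by
      have : Subsingleton (Fin (m s)) := by rw [hs]; infer_instance
      rw [Subsingleton.elim k]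
    rw [hval hya hyb, hval hxa hxb, hx]
    exact (mul_le_mul_of_nonneg_right (M.le_maxWeight g hya hyb) (Real.exp_pos _).le).trans
      (h (_, _))

lemma measurable_maxWeight [Fintype V] [DecidableEq V] [∀ i, Fintype (X i)] (a : X r) (b : X s) :
    Measurable fun g : M.NoiseIndex m → ℝ => M.maxWeight m r s g a b := by
  refine Measurable.iSup fun x => ?_
  unfold restNoise edgeNoise
  fun_prop

/-- The indices of the perturbations of the edges other than `(r, s)`. -/
abbrev OtherIndex (m : V → ℕ) (r s : V) : Type _ :=
  {q : M.NoiseIndex m // (q.1 : V × V) ≠ (r, s)}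

/-- The extension by zero of a perturbation of the edges other than `(r, s)`. -/
noncomputable def extendByZero [DecidableEq V] (o : M.OtherIndex m r s → ℝ)
    (i : M.NoiseIndex m) : ℝ :=
  if h : (i.1 : V × V) ≠ (r, s) then o ⟨i, h⟩ else 0

lemma measurable_extendByZero [DecidableEq V] :
    Measurable (M.extendByZero : (M.OtherIndex m r s → ℝ) → M.NoiseIndex m → ℝ) := by
  refine measurable_pi_lambda _ fun i => ?_
  unfold extendByZero
  split_ifs
  · exact measurable_pi_apply _
  · exact measurable_const

lemma maxWeight_extendByZero [Fintype V] [DecidableEq V] (g : M.NoiseIndex m → ℝ)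
    (a : X r) (b : X s) :
    M.maxWeight m r s (M.extendByZero fun i : M.OtherIndex m r s => g i) a b =
      M.maxWeight m r s g a b := by
  have : ∀ x : ExtAssignment X m,
      M.restNoise r s (M.extendByZero fun i : M.OtherIndex m r s => g i) x =
        M.restNoise r s g x := fun x => by
    refine Finset.sum_congr rfl fun e he => ?_
    have he' : (e : V × V) ≠ (r, s) := (Finset.mem_filter.1 he).2
    simp [edgeNoise, extendByZero, he']
  simp only [maxWeight, this]

lemma otherNoise_eq_comap {Ω : Type*} (γ : M.NoiseIndex m → Ω → ℝ) :
    M.otherNoise m γ r s = MeasurableSpace.comap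
      (fun ω (i : M.OtherIndex m r s) => γ i ω) MeasurableSpace.pi := by
  simp only [otherNoise, MeasurableSpace.pi, MeasurableSpace.comap_iSup,
    MeasurableSpace.comap_comp]
  rfl

/-- Given the perturbations of the other edges, the maximizer has the values `(a, b)` on the edge
`(r, s)` with probability proportional to `maxWeight`, by the Gumbel-max trick. -/
lemma condProb_mapEvent [Fintype V] [DecidableEq V] [∀ i, Fintype (X i)]
    [∀ i, Nonempty (X i)] (hrs : (r, s) ∈ M.edges) (hr : m r = 1) (hs : m s = 1)
    {Ω : Type*} [MeasurableSpace Ω] {μ : Measure Ω} [IsProbabilityMeasure μ]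
    {γ : M.NoiseIndex m → Ω → ℝ} (hind : iIndepFun γ μ) (hγ : ∀ q, IsZeroMeanGumbel μ (γ q))
    (hpos : ∀ g : M.NoiseIndex m → ℝ, 0 < ∑ q : X r × X s, M.maxWeight m r s g q.1 q.2)
    (a : X r) (b : X s) :
    ∀ᵐ ω ∂μ, (μ⟦M.mapEvent m γ r s a b | M.otherNoise m γ r s⟧) ω =
      M.maxWeight m r s (fun i => γ i ω) a b /
        ∑ q : X r × X s, M.maxWeight m r s (fun i => γ i ω) q.1 q.2 := by
  classical
  have : Fintype (M.OtherIndex m r s) := Fintype.ofFinite _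
  set Y : Ω → M.OtherIndex m r s → ℝ := fun ω i => γ i ω with hY
  set G : Ω → X r × X s → ℝ := fun ω q => γ (M.rootIndex hrs hr hs q) ω with hG
  have hYm : Measurable Y := measurable_pi_lambda _ fun i => (hγ i).1
  have hGm : Measurable G := measurable_pi_lambda _ fun q => (hγ _).1
  set W : (M.OtherIndex m r s → ℝ) → X r × X s → ℝ :=
    fun o q => M.maxWeight m r s (M.extendByZero o) q.1 q.2 with hW
  have hWm : ∀ q, Measurable fun o => W o q := fun q =>
    (M.measurable_maxWeight q.1 q.2).comp M.measurable_extendByZero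
  have hWY : ∀ ω q, W (Y ω) q = M.maxWeight m r s (fun i => γ i ω) q.1 q.2 := fun ω q =>
    M.maxWeight_extendByZero (fun i => γ i ω) q.1 q.2
  set A : Set ((M.OtherIndex m r s → ℝ) × (X r × X s → ℝ)) :=
    {z | ∀ q, W z.1 q * Real.exp (z.2 q) ≤ W z.1 (a, b) * Real.exp (z.2 (a, b))} with hA
  have hAm : MeasurableSet A := by
    rw [hA, Set.ofPred_forall]
    refine MeasurableSet.iInter fun q => measurableSet_le ?_ ?_
    · exact ((hWm q).comp measurable_fst).mul (by fun_prop)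
    · exact ((hWm (a, b)).comp measurable_fst).mul (by fun_prop)
  set f : (M.OtherIndex m r s → ℝ) × (X r × X s → ℝ) → ℝ := A.indicator fun _ => 1 with hf
  have hfm : StronglyMeasurable f := stronglyMeasurable_const.indicator hAm
  have hevent : (M.mapEvent m γ r s a b).indicator (fun _ => (1 : ℝ)) =
      fun ω => f (Y ω, G ω) := by
    funext ω
    have : ω ∈ M.mapEvent m γ r s a b ↔ (Y ω, G ω) ∈ A := by
      rw [M.mem_mapEvent_iff hrs hr hs]
      simp only [hA, Set.mem_ofPred_eq, hWY, hG]
    by_cases h : ω ∈ M.mapEvent m γ r s a b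
    · rw [Set.indicator_of_mem h, hf, Set.indicator_of_mem (this.1 h)]
    · rw [Set.indicator_of_notMem h, hf, Set.indicator_of_notMem (mt this.2 h)]
  have hindep : IndepFun Y G μ := indepFun_of_forall_ne hind (fun i => (hγ i).1)
    (u := fun i : M.OtherIndex m r s => (i : M.NoiseIndex m))
    (u' := fun q => M.rootIndex hrs hr hs q) fun i q h => i.2 (by rw [h]; rfl)
  have hint : Integrable (fun ω => f (Y ω, G ω)) μ := by
    refine (integrable_const (1 : ℝ)).mono'
      (hfm.comp_measurable (hYm.prodMk hGm)).aestronglyMeasurable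
      (Filter.Eventually.of_forall fun ω => ?_)
    simp only [hf, Set.indicator_apply]
    split_ifs <;> simp
  have hcond : condDistrib G Y μ =ᵐ[μ.map Y] Kernel.const _ (μ.map G) := by
    have := Measure.isProbabilityMeasure_map (μ := μ) hGm.aemeasurable
    rw [condDistrib_ae_eq_iff_measure_eq_compProd Y hGm.aemeasurable, Measure.compProd_const]
    exact (indepFun_iff_map_prod_eq_prod_map_map hYm.aemeasurable hGm.aemeasurable).1 hindep
  have hce := condExp_prod_ae_eq_integral_condDistrib hYm hGm.aemeasurable hfm hint
  rw [← otherNoise_eq_comap M γ, ← hevent] at hce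
  filter_upwards [hce, ae_of_ae_map hYm.aemeasurable hcond] with ω h1 h2
  rw [h1, h2, Kernel.const_apply]
  have hsec : (fun y => f (Y ω, y)) = (Prod.mk (Y ω) ⁻¹' A).indicator 1 := rfl
  rw [hsec, integral_indicator_one (measurable_prodMk_left hAm), map_measureReal_apply hGm
    (measurable_prodMk_left hAm)]
  have hmax := measureReal_isMax (Γ := fun q => γ (M.rootIndex hrs hr hs q))
    (hind.precomp (g := M.rootIndex hrs hr hs) fun q q' h => by simpa [rootIndex] using h)
    (fun q => hγ _) (w := W (Y ω)) (fun q => M.maxWeight_nonneg _ _ _)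
    (by simpa only [hWY] using hpos fun i => γ i ω) (a, b)
  simp only [hWY] at hmax
  rw [← hmax]
  congr 1
  ext ω'
  simp only [hA, hG, hWY, Set.mem_preimage, Set.mem_ofPred_eq]

end PairwiseModel

/-! ### The comparison of the perturbed maximizer with the marginals -/

namespace PairwiseModel

variable {V : Type*} [Fintype V] [DecidableEq V] {X : V → Type*} [∀ i, Fintype (X i)]
  {M : PairwiseModel V X} {m : V → ℕ} {r s : V} {c : ℕ}

/-- The sum of the edge weights `1 / (m_i m_j)` is at most the sum of the vertex weights `1 / m_i`,
since every edge can be charged to its child. -/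
lemma sum_edges_le (hm : ∀ i, 0 < m i)
    (B : ForestBounds c (M.edges.erase (r, s)) ((Finset.univ.erase r).erase s) M.weight) :
    ∑ e ∈ M.otherEdges r s, ((m e.1.1 : ℝ) * (m e.1.2 : ℝ))⁻¹ ≤
      ∑ i ∈ (Finset.univ.erase r).erase s, (m i : ℝ)⁻¹ := by
  have h1 : ∀ i, (1 : ℝ) ≤ m i := fun i => by exact_mod_cast hm i
  have h0 : ∀ i, (0 : ℝ) < m i := fun i => one_pos.trans_le (h1 i)
  calc ∑ e ∈ M.otherEdges r s, ((m e.1.1 : ℝ) * (m e.1.2 : ℝ))⁻¹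
      = ∑ e ∈ M.edges.erase (r, s), ((m e.1 : ℝ) * (m e.2 : ℝ))⁻¹ :=
        (M.sum_otherEdges r s fun e => ((m e.1 : ℝ) * (m e.2 : ℝ))⁻¹).symm
    _ ≤ ∑ e ∈ M.edges.erase (r, s), (m (B.child e) : ℝ)⁻¹ := by
        refine Finset.sum_le_sum fun e he => inv_anti₀ (h0 _) ?_
        rcases B.child_eq e he with h | h <;> rw [h]
        · exact le_mul_of_one_le_right (h0 _).le (h1 _)
        · exact le_mul_of_one_le_left (h0 _).le (h1 _)
    _ = ∑ i ∈ (M.edges.erase (r, s)).image B.child, (m i : ℝ)⁻¹ :=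
        (Finset.sum_image (f := fun i => (m i : ℝ)⁻¹) B.child_injOn).symm
    _ ≤ _ := Finset.sum_le_sum_of_subset_of_nonneg
        (Finset.image_subset_iff.2 B.child_mem) fun i _ _ => inv_nonneg.2 (h0 i).le

variable {Ω : Type*} [MeasurableSpace Ω] {μ : Measure Ω} [IsProbabilityMeasure μ]
  {γ : M.NoiseIndex m → Ω → ℝ}

/-- The probability that the total deviation is large. -/
lemma measureReal_deviation_le (hm : ∀ i, 0 < m i) (hind : iIndepFun γ μ)
    (hγ : ∀ q, IsZeroMeanGumbel μ (γ q))
    (B : ForestBounds c (M.edges.erase (r, s)) ((Finset.univ.erase r).erase s) M.weight)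
    {d : ℝ} (hd : 0 < d) :
    μ.real {ω | d ≤ upperDeviation B (fun i => γ i ω) + lowerDeviation B (fun i => γ i ω)} ≤
      ((Finset.univ.erase r).erase s).card * (2 * (c + 1) * (Real.pi ^ 2 / 6) *
        ∑ i ∈ (Finset.univ.erase r).erase s, (m i : ℝ)⁻¹) / d ^ 2 := by
  have hdev := fun e (he : e ∈ M.otherEdges r s) =>
    integral_edgeDeviation_sq_le hind hγ (p := B.factor) (Q := B.good)
      (B.factor_nonneg e (M.mem_erase_of_mem_otherEdges he))
      (one_pos.trans_le (B.one_le_sum_factor e (M.mem_erase_of_mem_otherEdges he)))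
      (B.card_good_le e (M.mem_erase_of_mem_otherEdges he))
  have h := measureReal_le_sum (M.otherEdges r s) (fun e he => (hdev e he).1)
    (fun e he => (hdev e he).2) hd
  have hset : {ω | d ≤ upperDeviation B (fun i => γ i ω) + lowerDeviation B (fun i => γ i ω)} =
      {ω | d ≤ ∑ e ∈ M.otherEdges r s,
        M.edgeDeviation m B.factor B.good (fun i => γ i ω) e} := by
    ext ω
    rw [Set.mem_ofPred_eq, Set.mem_ofPred_eq, upperDeviation, lowerDeviation, add_comm,
      ← Finset.sum_add_distrib]
    rfl
  rw [hset]
  refine h.trans ?_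
  have hcard : ((M.otherEdges r s).card : ℝ) ≤ ((Finset.univ.erase r).erase s).card := by
    exact_mod_cast card_otherEdges_le B
  rw [show ∑ e ∈ M.otherEdges r s, 2 * ((c : ℝ) + 1) * (Real.pi ^ 2 / 6) /
      ((m e.1.1 : ℝ) * (m e.1.2 : ℝ)) = 2 * (c + 1) * (Real.pi ^ 2 / 6) *
        ∑ e ∈ M.otherEdges r s, ((m e.1.1 : ℝ) * (m e.1.2 : ℝ))⁻¹ by
    rw [Finset.mul_sum]; rfl]
  gcongr
  exact sum_edges_le hm B

/-- When the total deviation is small, the distribution of the perturbed maximizer on the edge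
`(r, s)` and its Gibbs marginal agree up to a factor. -/
lemma ratios_le_of_deviation_le [∀ i, Nonempty (X i)] (hm : ∀ i, 0 < m i) (hc1 : 1 ≤ c)
    (hrs : (r, s) ∈ M.edges)
    (B : ForestBounds c (M.edges.erase (r, s)) ((Finset.univ.erase r).erase s) M.weight)
    (g : M.NoiseIndex m → ℝ) (hpos : 0 < ∑ q : X r × X s, M.marginal r s q.1 q.2) {t : ℝ}
    (ht : 2 * ((Finset.univ.erase r).erase s).card * Real.log c +
      (upperDeviation B g + lowerDeviation B g) ≤ t) (a : X r) (b : X s) :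
    0 < ∑ q : X r × X s, M.maxWeight m r s g q.1 q.2 ∧
    M.maxWeight m r s g a b / (∑ q : X r × X s, M.maxWeight m r s g q.1 q.2) ≤
      M.marginal r s a b / (∑ q : X r × X s, M.marginal r s q.1 q.2) * Real.exp t ∧
    M.marginal r s a b / (∑ q : X r × X s, M.marginal r s q.1 q.2) ≤
      M.maxWeight m r s g a b / (∑ q : X r × X s, M.maxWeight m r s g q.1 q.2) *
        Real.exp t := by
  have hne : r ≠ s := M.ne_of_mem_edges hrs
  set u : X r × X s → ℝ := fun q => M.maxWeight m r s g q.1 q.2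
  set v : X r × X s → ℝ := fun q => M.marginal r s q.1 q.2
  set K := Real.exp (((Finset.univ.erase r).erase s).card * Real.log c + upperDeviation B g)
  set L := Real.exp (((Finset.univ.erase r).erase s).card * Real.log c + lowerDeviation B g)
  have hu : ∀ q, 0 ≤ u q := fun q => M.maxWeight_nonneg g _ _
  have hv : ∀ q, 0 ≤ v q := fun q => M.marginal_nonneg r s _ _
  have huv : ∀ q, u q ≤ v q * K := fun q => by
    obtain ⟨x, ha, hb, hx⟩ := M.exists_eq_maxWeight hne g q.1 q.2
    simp only [u, ← hx]
    exact extWeight_mul_exp_le B hm hc1 g ha hb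
  have hvu : ∀ q, v q ≤ u q * L := fun q => marginal_le_maxWeight B hm hc1 hne g q.1 q.2
  have hupos : 0 < ∑ q, u q := by
    refine pos_of_mul_pos_left (hpos.trans_le ?_) (Real.exp_pos (((Finset.univ.erase r).erase
      s).card * Real.log c + lowerDeviation B g)).le
    rw [Finset.sum_mul]
    exact Finset.sum_le_sum fun q _ => hvu q
  have hKL : K * L ≤ Real.exp t := by
    rw [← Real.exp_add]
    exact Real.exp_le_exp.2 (by linarith)
  refine ⟨hupos, ?_, ?_⟩
  · refine (div_sum_le_div_sum_mul (Real.exp_pos _) hu huv hvu hupos (a, b)).trans ?_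
    exact mul_le_mul_of_nonneg_left hKL (div_nonneg (hv (a, b)) hpos.le)
  · refine (div_sum_le_div_sum_mul (Real.exp_pos _) hv hvu huv hpos (a, b)).trans ?_
    rw [mul_comm L K]
    exact mul_le_mul_of_nonneg_left hKL (div_nonneg (hu (a, b)) hupos.le)

end PairwiseModel

theorem mainTheorem2 {V : Type*} [Fintype V] [DecidableEq V] {X : V → Type*}
    [∀ i, Fintype (X i)] (M : PairwiseModel V X)
    (hacyclic : M.graph.IsAcyclic)
    (hdom : ∃ x : ∀ i, X i, M.potential x ≠ ⊥)
    (m : V → ℕ) (hm : ∀ i, 0 < m i)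
    {Ω : Type*} [MeasurableSpace Ω] (μ : Measure Ω) [IsProbabilityMeasure μ]
    (γ : M.NoiseIndex m → Ω → ℝ)
    (hindep : iIndepFun γ μ)
    (hgumbel : ∀ q, IsZeroMeanGumbel μ (γ q))
    (r s : V) (hrs : (r, s) ∈ M.edges) (hr : m r = 1) (hs : m s = 1)
    (ε : ℝ) (hε : 0 < ε) :
    1 - ∑ i : V, Real.pi ^ 2 * ((Finset.univ.sup fun j : V => Fintype.card (X j) : ℕ) : ℝ) /
        (6 * (m i : ℝ) * ε ^ 2) ≤
      μ.real {ω | ∀ (a : X r) (b : X s),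
        M.logMapProb m μ γ r s a b ω ≤
          ENNReal.log (M.gibbsMarginal r s a b) + ((ε * Fintype.card V : ℝ) : EReal) ∧
        ENNReal.log (M.gibbsMarginal r s a b) ≤
          M.logMapProb m μ γ r s a b ω + ((ε * Fintype.card V : ℝ) : EReal)} := by
  set c : ℕ := Finset.univ.sup fun j : V => Fintype.card (X j)
  obtain ⟨x₀, hx₀⟩ := hdom
  have hX : ∀ i, Nonempty (X i) := fun i => ⟨x₀ i⟩
  have hc : ∀ i, Fintype.card (X i) ≤ c := fun i =>
    Finset.le_sup (f := fun j : V => Fintype.card (X j)) (Finset.mem_univ i)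
  have hc1 : 1 ≤ c := Fintype.card_pos.trans_le (hc r)
  have hc1' : (1 : ℝ) ≤ c := by exact_mod_cast hc1
  have hne : r ≠ s := M.ne_of_mem_edges hrs
  obtain ⟨B⟩ := M.nonempty_forestBounds_weight hacyclic hrs hc
  have hpos : 0 < ∑ q : X r × X s, M.marginal r s q.1 q.2 := by
    rw [M.sum_marginal]
    exact Finset.sum_pos' (fun x _ => M.weight_nonneg x)
      ⟨x₀, Finset.mem_univ _, M.weight_pos hx₀⟩
  set U : Finset V := (Finset.univ.erase r).erase s with hU
  set v : ℝ := ∑ i ∈ U, (m i : ℝ)⁻¹ with hv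
  have hv0 : 0 ≤ v := Finset.sum_nonneg fun i _ => by positivity
  have hsU : s ∈ (Finset.univ.erase r : Finset V) := by simp [hne.symm]
  have hN : (Fintype.card V : ℝ) = U.card + 2 := by
    have h1 := Finset.card_erase_add_one hsU
    rw [← hU] at h1
    have h2 := Finset.card_erase_add_one (Finset.mem_univ r)
    rw [Finset.card_univ] at h2
    have : Fintype.card V = U.card + 2 := by omega
    exact_mod_cast this
  have hbudget : ∑ i : V, Real.pi ^ 2 * (c : ℝ) / (6 * (m i : ℝ) * ε ^ 2) =
      c * (Real.pi ^ 2 / 6) * (2 + v) / ε ^ 2 := by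
    have h1 : ∑ i : V, (m i : ℝ)⁻¹ = 2 + v := by
      rw [← Finset.add_sum_erase _ _ (Finset.mem_univ r), ← Finset.add_sum_erase _ _ hsU, hr, hs,
        ← hU, ← hv]
      norm_num
      ring
    rw [← h1, Finset.mul_sum, Finset.sum_div]
    refine Finset.sum_congr rfl fun i _ => ?_
    field_simp
  rw [hbudget]
  -- A bound that is not positive is trivial, so `ε` may be assumed to be large.
  rcases le_or_gt (ε ^ 2) (c * (Real.pi ^ 2 / 6) * (2 + v)) with hsmall | hlarge
  · refine le_trans ?_ measureReal_nonneg
    rw [sub_nonpos, one_le_div (by positivity)]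
    exact hsmall
  have hB : (3 / 2 : ℝ) ≤ Real.pi ^ 2 / 6 := by nlinarith [Real.pi_gt_three]
  have hℓ := sq_log_le hc1'
  obtain ⟨hd, hle⟩ := markov_bound_le (N := U.card) (ℓ := Real.log c) (by positivity) hv0 hε hc1'
    (by linarith : 0 < Real.pi ^ 2 / 6) (by nlinarith) hlarge.le
  set d : ℝ := ε * (U.card + 2) - 2 * U.card * Real.log c
  have hbad := (PairwiseModel.measureReal_deviation_le hm hindep hgumbel B hd).trans hle
  set F : Set Ω :=
    {ω | d ≤ PairwiseModel.upperDeviation B (fun i => γ i ω) +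
      PairwiseModel.lowerDeviation B (fun i => γ i ω)} with hF
  have hmain := fun (g : M.NoiseIndex m → ℝ) (t : ℝ) ht =>
    PairwiseModel.ratios_le_of_deviation_le hm hc1 hrs B g hpos (t := t) ht
  have hWpos : ∀ g : M.NoiseIndex m → ℝ,
      0 < ∑ q : X r × X s, M.maxWeight m r s g q.1 q.2 := fun g =>
    (hmain g _ le_rfl (x₀ r) (x₀ s)).1
  have hcond : ∀ᵐ ω ∂μ, ∀ (a : X r) (b : X s),
      (μ⟦M.mapEvent m γ r s a b | M.otherNoise m γ r s⟧) ω =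
        M.maxWeight m r s (fun i => γ i ω) a b /
          ∑ q : X r × X s, M.maxWeight m r s (fun i => γ i ω) q.1 q.2 :=
    ae_all_iff.2 fun a => ae_all_iff.2 fun b =>
      M.condProb_mapEvent hrs hr hs hindep hgumbel hWpos a b
  have hsub : (Fᶜ : Set Ω) ≤ᵐ[μ] {ω | ∀ (a : X r) (b : X s),
        M.logMapProb m μ γ r s a b ω ≤
          ENNReal.log (M.gibbsMarginal r s a b) + ((ε * Fintype.card V : ℝ) : EReal) ∧
        ENNReal.log (M.gibbsMarginal r s a b) ≤
          M.logMapProb m μ γ r s a b ω + ((ε * Fintype.card V : ℝ) : EReal)} := by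
    filter_upwards [hcond] with ω hω (hωF : ω ∉ F)
    intro a b
    rw [hF, Set.mem_ofPred_eq, not_le] at hωF
    obtain ⟨hp, h1, h2⟩ := hmain (fun i => γ i ω) (ε * Fintype.card V)
      (by rw [hN]; linarith) a b
    rw [PairwiseModel.logMapProb, hω a b, M.gibbsMarginal_eq ⟨x₀, hx₀⟩]
    exact ⟨log_ofReal_le_add (div_nonneg (M.marginal_nonneg _ _ _ _) hpos.le) h1,
      log_ofReal_le_add (div_nonneg (M.maxWeight_nonneg _ _ _) hp.le) h2⟩
  have hcompl : 1 - μ.real F ≤ μ.real Fᶜ := by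
    have := measureReal_union_le (μ := μ) F Fᶜ
    rw [Set.union_compl_self, probReal_univ] at this
    linarith
  have hmono : μ.real Fᶜ ≤ _ :=
    ENNReal.toReal_mono (measure_ne_top _ _) (measure_mono_ae hsub)
  exact le_trans (by linarith) hmono
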